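/- There is an absolute constant $A>0$ such that for every $\varepsilon>0$ there is a constant $K=K(\varepsilon)>0$ with the following property. For every $n$ there is a randomized one-pass W-streaming algorithm, which depends on $n$ and $\varepsilon$ but is not told the maximum degree or the number of edges of its input, such that for every simple graph $G$ on $n$ labelled vertices, with maximum degree $\Delta$, and for every order in which the edges of $G$ arrive in the stream (fixed independently of the random choices of the algorithm), the algorithm outputs, with probability $1$, a proper edge coloring of $G$ (each edge is printed exactly once together with its color, and adjacent edges get different colors), and $$\mathbb E[\text{space}]\le K\,(\max\{1,\log\Delta\})^{A/\varepsilon}\,n,\qquad \mathbb E[\text{number of different colors}]\le K\,(\max\{1,\log\Delta\})^{A/\varepsilon}\,\Delta^{4/3+\varepsilon}.$$ Here a W-streaming algorithm reads the edges one by one, once, keeps only its memory between two consecutive edges, and writes its answers to a write-only output stream. Each of its steps (the choice of the initial memory, the reaction to an edge, and the final output after the last edge) is an arbitrary random function of the current memory and the edge just read, with fresh randomness; random values needed later must be kept in memory. The space is the largest number of memory words held between steps during the run, where one word stores one of $n$ values ($\log_2 n$ bits). -/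

import Mathlib

open scoped ENNReal

noncomputable section

/-- A randomized one-pass W-streaming algorithm for `n`-vertex graphs with vertex set `Fin n`.

Between two stream items the algorithm remembers only its memory, a list of machine words; one word
holds a number below `n`, that is, `log₂ n` bits. Every operation may use fresh random choices;
random values that are needed again later have to be kept in memory. Output items (edges together
with their colors) go to a write-only output stream and do not occupy memory. -/
structure WStreamAlgorithm (n : ℕ) where
  /-- The (random) memory contents before the first edge is read. -/
  init : PMF (List (Fin n))
  /-- Read one edge of the stream: new memory contents, and what is written to the output. -/
  step : List (Fin n) → Sym2 (Fin n) → PMF (List (Fin n) × List (Sym2 (Fin n) × ℕ))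
  /-- The end of the input stream is reached: what is written to the output. -/
  finish : List (Fin n) → PMF (List (Sym2 (Fin n) × ℕ))

namespace WStreamAlgorithm

variable {n : ℕ}

/-- Run the algorithm on the rest of a stream from given memory contents. The result is the joint
distribution of the peak memory usage in words, and of the whole output written. -/
def runFrom (𝒜 : WStreamAlgorithm n) :
    List (Sym2 (Fin n)) → List (Fin n) → PMF (ℕ × List (Sym2 (Fin n) × ℕ))
  | [], s => (𝒜.finish s).map fun out => (s.length, out)
  | e :: es, s => (𝒜.step s e).bind fun p =>
      (𝒜.runFrom es p.1).map fun r => (max s.length r.1, p.2 ++ r.2)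

/-- Run the algorithm on a whole stream: the joint distribution of the space used (the largest number
of memory words at any time) and of the output. -/
def run (𝒜 : WStreamAlgorithm n) (es : List (Sym2 (Fin n))) :
    PMF (ℕ × List (Sym2 (Fin n) × ℕ)) :=
  𝒜.init.bind fun s => 𝒜.runFrom es s

/-- The expected space, in words, used on a stream. -/
def expectedSpace (𝒜 : WStreamAlgorithm n) (es : List (Sym2 (Fin n))) : ℝ≥0∞ :=
  ∑' r, 𝒜.run es r * (r.1 : ℝ≥0∞)

/-- The expected number of different colors in the output on a stream. -/
def expectedColors (𝒜 : WStreamAlgorithm n) (es : List (Sym2 (Fin n))) : ℝ≥0∞ :=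
  ∑' r, 𝒜.run es r * ((r.2.map Prod.snd).toFinset.card : ℝ≥0∞)

end WStreamAlgorithm

/-- `es` lists every edge of `G` exactly once, in some order. -/
def IsEdgeStream {n : ℕ} (G : SimpleGraph (Fin n)) (es : List (Sym2 (Fin n))) : Prop :=
  es.Nodup ∧ ∀ e, e ∈ es ↔ e ∈ G.edgeSet

/-- The output `out` is a proper edge coloring of `G`: every edge of `G`, and nothing else, is given
a color, exactly once, and two different edges with a common endpoint get different colors. -/
def IsProperEdgeColoring {n : ℕ} (G : SimpleGraph (Fin n)) (out : List (Sym2 (Fin n) × ℕ)) : Prop :=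
  IsEdgeStream G (out.map Prod.fst) ∧
    ∀ p ∈ out, ∀ q ∈ out, p.1 ≠ q.1 → (∃ v, v ∈ p.1 ∧ v ∈ q.1) → p.2 ≠ q.2

end

/-!
The vertices draw random hash values once, and everything else is deterministic. The stream is cut
into batches of `n` edges. A batch is kept in memory until it is complete; then almost all of its
edges get a color and are printed, and the few remaining ones stay in memory until the end, when
they are colored greedily with `2 Δ` further colors.

Let `Δ = 8 ^ i = s ^ 3` be the current bound for the degrees, so that there are fewer than `Δ`
batches so far, and let `u v` be an edge of a batch in which `u` has degree `a` and `v` has degree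
`b`, up to factors of `2`. Its color is a part of the time, a clock of `u`, a clock of `v` and a
hash value. For each endpoint, the named part of the time and the clock determine the batch
(`Batch.rawClock_ne`), so there are no conflicts between batches (`Batch.color_ne_of_before`). The
clock of a vertex is shifted by a random amount, hence different neighbors of `u` rarely agree in
both the clock and the hash value, if these take many more than `a` values together. The point is to
do this with a palette of size about `s ^ 4 = Δ ^ (4 / 3)` (`Scheme.exponent_sum_le`):
* if `a, b ≤ s`, name the time completely, and use `s` hash values;
* if `a b ≥ s ^ 2`, the degree of `u` so far divided by `a` is a clock with `Δ / a` values, and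
  similarly for `v`; these clocks suffice, without the time;
* otherwise, say, `b < s < a < s ^ 2`. Consider an epoch of `s` consecutive batches; there are
  `s ^ 2` epochs. As long as `u` has at most `s ^ 2` edges in the epoch, name the epoch; a clock of
  `u` with `s ^ 2 / a` values is enough, and `v` uses the position of the batch in the epoch.
  If `u` has more edges in the epoch, this happens in at most `s` epochs, and they are told apart
  by the degree of `u` at the start of the epoch divided by `s ^ 2`; so it is enough to name the
  position of the batch in the epoch, and `v` uses the number of the epoch.

To tell the roles of the two endpoints apart, the vertices are split into random sides. With
palettes larger by a factor of `2 ^ (O(t))`, an edge is in conflict within its batch, or has both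
endpoints on one side, with probability `O(2 ^ (-t))`
(`Batch.WellFormed.card_not_good_le`). With `2 ^ t` about `Δ ^ (1 / (3 q))` and `6 q` independent
rounds, an edge has no color after all rounds with probability `O(Δ ^ (-2))`. Since the batch number
`τ` has `Δ ≥ τ + 1`, the expected number of uncolored edges is at most
`O(n) * ∑ 1 / (τ + 1) ^ 2 = O(n)` (`sum_length_leftover_le`).

The memory holds the hash values, which are `O(q)` words for each vertex, the current degrees and
those at the start of the epoch, the incomplete batch, and the uncolored edges.
-/

open scoped ENNReal

noncomputable section

/-! ### Deterministic machines with a random seed -/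

/-- A streaming machine whose only random choice is the initial state: a transition function and a
final output function on states of type `σ`. -/
structure SeededMachine (n : ℕ) (σ : Type) where
  /-- Read an edge: new state and output. -/
  step : σ → Sym2 (Fin n) → σ × List (Sym2 (Fin n) × ℕ)
  /-- Output at the end of the stream. -/
  finish : σ → List (Sym2 (Fin n) × ℕ)

namespace SeededMachine

variable {n : ℕ} {σ Ω : Type}

/-- Peak of the state size and whole output, when the machine is run from a given state. -/
def exec (M : SeededMachine n σ) (size : σ → ℕ) :
    List (Sym2 (Fin n)) → σ → ℕ × List (Sym2 (Fin n) × ℕ)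
  | [], s => (size s, M.finish s)
  | e :: es, s =>
      let r := M.exec size es (M.step s e).1
      (max (size s) r.1, (M.step s e).2 ++ r.2)

/-- The W-streaming algorithm that keeps the state of `M` in memory through the encoding `enc`, and
draws the initial state from a uniform seed. -/
def toAlgorithm [Nonempty σ] [Fintype Ω] [Nonempty Ω] (M : SeededMachine n σ)
    (enc : σ → List (Fin n)) (start : Ω → σ) : WStreamAlgorithm n where
  init := (PMF.uniformOfFintype Ω).map fun ω => enc (start ω)
  step w e := PMF.pure (enc (M.step (Function.invFun enc w) e).1,
    (M.step (Function.invFun enc w) e).2)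
  finish w := PMF.pure (M.finish (Function.invFun enc w))

variable [Nonempty σ] [Fintype Ω] [Nonempty Ω] (M : SeededMachine n σ)
  {enc : σ → List (Fin n)} (start : Ω → σ)

theorem runFrom_toAlgorithm (henc : Function.Injective enc) (es : List (Sym2 (Fin n))) (s : σ) :
    (M.toAlgorithm enc start).runFrom es (enc s) =
      PMF.pure (M.exec (fun s => (enc s).length) es s) := by
  induction es generalizing s with
  | nil =>
    simp [WStreamAlgorithm.runFrom, toAlgorithm, exec, Function.leftInverse_invFun henc s,
      PMF.pure_map]
  | cons e es ih =>
    have h : Function.invFun enc (enc s) = s := Function.leftInverse_invFun henc s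
    rw [WStreamAlgorithm.runFrom]
    simp only [toAlgorithm, h, PMF.pure_bind]
    have := ih (M.step s e).1
    simp only [toAlgorithm] at this
    rw [this, PMF.pure_map]
    rfl

theorem run_toAlgorithm (henc : Function.Injective enc) (es : List (Sym2 (Fin n))) :
    (M.toAlgorithm enc start).run es = (PMF.uniformOfFintype Ω).map fun ω =>
      M.exec (fun s => (enc s).length) es (start ω) := by
  unfold WStreamAlgorithm.run
  have : (M.toAlgorithm enc start).init =
    (PMF.uniformOfFintype Ω).map fun ω => enc (start ω) := rfl
  rw [this, PMF.bind_map]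
  simp only [Function.comp_def, M.runFrom_toAlgorithm start henc]
  rfl

end SeededMachine

theorem PMF.tsum_map_mul {α β : Type} (p : PMF α) (g : α → β) (φ : β → ℝ≥0∞) :
    ∑' b, p.map g b * φ b = ∑' a, p a * φ (g a) := by
  have : ∀ b, p.map g b * φ b = ∑' a, p a * (PMF.pure (g a) b * φ b) := fun b => by
    rw [← PMF.bind_pure_comp, PMF.bind_apply, ← ENNReal.tsum_mul_right]
    simp
  simp_rw [this]
  rw [ENNReal.tsum_comm]
  congr 1
  ext a
  rw [ENNReal.tsum_mul_left]
  congr 1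
  rw [tsum_eq_single (g a)]
  · simp
  · intro b hb
    simp [PMF.pure_apply, hb]

/-- An average over a uniform seed is bounded by any bound of the corresponding finite sum. -/
theorem PMF.tsum_map_uniform_mul_le {Ω β : Type} [Fintype Ω] [Nonempty Ω] (g : Ω → β) (φ : β → ℕ)
    {B : ℝ} (hB : ∑ ω, (φ (g ω) : ℝ) ≤ B * Fintype.card Ω) :
    ∑' b, (PMF.uniformOfFintype Ω).map g b * (φ b : ℝ≥0∞) ≤ ENNReal.ofReal B := by
  rw [PMF.tsum_map_mul, tsum_fintype]
  have hc : (0 : ℝ) < Fintype.card Ω := by exact_mod_cast Fintype.card_pos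
  simp only [PMF.uniformOfFintype_apply]
  rw [← Finset.mul_sum]
  have : (∑ ω, (φ (g ω) : ℝ≥0∞)) = ENNReal.ofReal (∑ ω, (φ (g ω) : ℝ)) := by
    rw [ENNReal.ofReal_sum_of_nonneg (fun _ _ => by positivity)]
    simp
  rw [this]
  have h2 : ((Fintype.card Ω : ℝ≥0∞))⁻¹ = ENNReal.ofReal ((Fintype.card Ω : ℝ)⁻¹) := by
    rw [ENNReal.ofReal_inv_of_pos hc]; simp
  rw [h2, ← ENNReal.ofReal_mul (by positivity)]
  apply ENNReal.ofReal_le_ofReal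
  rw [inv_mul_le_iff₀ hc]
  linarith

/-! ### The coloring of one batch -/

/-- How the color of an edge avoids earlier colors at its endpoints. Write `s = 2 ^ scale`, and call
`s` consecutive batches of the same scale an epoch.
* `fresh`: the color names the batch, so it is never used again.
* `clock`: each endpoint restricts the color by its own clock, its degree so far.
* `epoch`: the color names the epoch; the endpoint of higher level uses its clock within the epoch,
  the other one the position of the batch in the epoch.
* `dense`: the color names the position of the batch in its epoch; the endpoint of higher level,
  which receives more than `s ^ 2` edges in this epoch and hence in few epochs, uses its degree at
  the start of the epoch, the other endpoint the number of the epoch. -/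
inductive Scheme
  | fresh | clock | epoch | dense
  deriving DecidableEq

instance : Fintype Scheme :=
  ⟨{.fresh, .clock, .epoch, .dense}, fun S => by cases S <;> simp⟩

/-- A batch of edges, with what has to be known about the past of the stream to color it. -/
structure Batch (V : Type) where
  /-- The number of earlier batches. -/
  idx : ℕ
  /-- The number `i` such that all degrees so far are at most `8 ^ i`. -/
  scale : ℕ
  /-- The degree of each vertex before the batch. -/
  pre : V → ℕ
  /-- The degree of each vertex after the batch. -/
  post : V → ℕ
  /-- The degree of each vertex at the start of the current epoch. -/
  base : V → ℕ
  /-- The edges of the batch. -/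
  edges : List (Sym2 V)

/-- A color: the round, scale, levels of the endpoints, scheme, the part of the time named by the
scheme, one attribute for each endpoint, and a hash value that separates the edges of one batch. The
right summand is a separate palette for edges colored at the end of the stream. -/
abbrev Color := ((ℕ × ℕ × ℕ × ℕ × Scheme × ℕ) × Sym2 (ℕ × ℕ × ℕ) × ℕ) ⊕ ℕ

namespace Scheme

/-- The part of the time named by the color. -/
def time (i τ : ℕ) : Scheme → ℕ
  | fresh => τ
  | clock => 0
  | epoch => τ / 2 ^ i
  | dense => τ % 2 ^ i

/-- The range of `time` is `2 ^ timeExp`. -/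
def timeExp (i : ℕ) : Scheme → ℕ
  | fresh => 3 * i
  | clock => 0
  | epoch => 2 * i
  | dense => i

/-- The clock of a vertex of level `k` takes `2 ^ clockExp` values, where `hi` is the larger level
of the two endpoints. -/
def clockExp (i hi k : ℕ) : Scheme → ℕ
  | fresh => 0
  | clock => 3 * i - k
  | epoch => if k = hi then 2 * i - k else i
  | dense => if k = hi then i else 2 * i

/-- The hash value of an edge takes `2 ^ (hashExp + t)` values; the factor `2 ^ t` makes collisions
rare. -/
def hashExp (i hi lo : ℕ) : Scheme → ℕ
  | fresh => hi
  | clock => hi + lo - 3 * i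
  | epoch => hi - i
  | dense => 0

/-- The levels `lo ≤ hi` for which a scheme is used. -/
def Admissible (i hi lo : ℕ) : Scheme → Prop
  | fresh => hi ≤ i
  | clock => 2 * i ≤ hi + lo
  | _ => i < hi ∧ hi + lo < 2 * i

/-- The palette of one scheme has size about `2 ^ (4 * i)`, that is, `Δ ^ (4 / 3)` for
`Δ = 8 ^ i`. -/
theorem exponent_sum_le {i hi lo : ℕ} {S : Scheme} (hlo : lo ≤ hi) (hhi : hi ≤ 3 * i)
    (h : S.Admissible i hi lo) :
    S.timeExp i + S.clockExp i hi hi + S.clockExp i hi lo + S.hashExp i hi lo ≤ 4 * i := by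
  cases S <;> simp only [Admissible, timeExp, clockExp, hashExp] at * <;>
    first | omega | (split_ifs <;> omega)

/-- The clock of one endpoint and the hash value together have enough room for the edges that the
other endpoint, of level `k`, has in the batch. -/
theorem level_le_clockExp_add {i hi lo k l : ℕ} {S : Scheme} (h : S.Admissible i hi lo)
    (hhi : hi ≤ 3 * i) (hk : k ⊔ l = hi) (hl : k ⊓ l = lo) :
    k ≤ S.clockExp i hi l + S.hashExp i hi lo := by
  cases S <;> simp only [Admissible, clockExp, hashExp] at * <;>
    first | omega | (split_ifs <;> omega)

theorem clockExp_le {i hi k : ℕ} (S : Scheme) : S.clockExp i hi k ≤ 3 * i := by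
  cases S <;> simp only [clockExp] <;> first | omega | (split_ifs <;> omega)

theorem hashExp_le {i hi lo : ℕ} {S : Scheme} (hlo : lo ≤ hi) (hhi : hi ≤ 3 * i) :
    S.hashExp i hi lo ≤ 3 * i := by
  cases S <;> simp only [hashExp] <;> omega

end Scheme

namespace Batch

variable {V : Type} (b : Batch V)

/-- The logarithm of the degree of a vertex in the batch. -/
def level (v : V) : ℕ := Nat.log 2 (b.post v - b.pre v)

/-- The larger level of the endpoints of an edge. -/
def hi (f : Sym2 V) : ℕ := (f.map b.level).sup

/-- The smaller level of the endpoints of an edge. -/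
def lo (f : Sym2 V) : ℕ := (f.map b.level).inf

open scoped Classical in
/-- The scheme used for an edge. -/
def scheme (f : Sym2 V) : Scheme :=
  if b.hi f ≤ b.scale then .fresh
  else if 2 * b.scale ≤ b.hi f + b.lo f then .clock
  else if ∃ w ∈ f, b.level w = b.hi f ∧ b.base w + 4 ^ b.scale < b.post w then .dense
  else .epoch

/-- The clock of a vertex for a given scheme and a given larger level of the two endpoints. -/
def rawClock (S : Scheme) (hi : ℕ) (v : V) : ℕ :=
  match S with
  | .fresh => 0
  | .clock => b.pre v / 2 ^ b.level v
  | .epoch => if b.level v = hi then (b.pre v - b.base v) / 2 ^ b.level v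
      else b.idx % 2 ^ b.scale
  | .dense => if b.level v = hi then b.base v / 4 ^ b.scale else b.idx / 2 ^ b.scale

/-- The clock of a vertex, shifted at random. -/
def clock (h : V → ℕ × ℕ) (S : Scheme) (hi : ℕ) (v : V) : ℕ :=
  (b.rawClock S hi v + (h v).1) % 2 ^ S.clockExp b.scale hi (b.level v)

/-- The random side of a vertex; only edges between different sides are colored. -/
def side (t : ℕ) (h : V → ℕ × ℕ) (v : V) : ℕ := (h v).2 % 2 ^ t

/-- The contribution of an endpoint to the color of an edge. -/
def attr (t : ℕ) (h : V → ℕ × ℕ) (S : Scheme) (hi : ℕ) (v : V) : ℕ × ℕ × ℕ :=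
  (side t h v, b.level v, b.clock h S hi v)

/-- The hash value of an edge, given the number of bits. -/
def hash (h : V → ℕ × ℕ) (e : ℕ) (f : Sym2 V) : ℕ :=
  Sym2.lift ⟨fun x y => ((h x).2 + (h y).2) % 2 ^ e, fun x y => by simp only [add_comm]⟩ f

/-- The color of an edge in a round with hash functions `h`. -/
def color (t ρ : ℕ) (h : V → ℕ × ℕ) (f : Sym2 V) :
    (ℕ × ℕ × ℕ × ℕ × Scheme × ℕ) × Sym2 (ℕ × ℕ × ℕ) × ℕ :=
  ((ρ, b.scale, b.hi f, b.lo f, b.scheme f, (b.scheme f).time b.scale b.idx),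
    f.map (b.attr t h (b.scheme f) (b.hi f)),
    hash h ((b.scheme f).hashExp b.scale (b.hi f) (b.lo f) + t) f)

/-- An edge is good in a round if its endpoints are on different sides, and no adjacent edge of the
batch has the same color. -/
def Good (t ρ : ℕ) (h : V → ℕ × ℕ) (f : Sym2 V) : Prop :=
  (∀ x y, f = s(x, y) → side t h x ≠ side t h y) ∧
    ∀ f' ∈ b.edges, f' ≠ f → (∃ w, w ∈ f ∧ w ∈ f') → b.color t ρ h f' ≠ b.color t ρ h f

@[simp] theorem hi_mk (x y : V) : b.hi s(x, y) = b.level x ⊔ b.level y := rfl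

@[simp] theorem lo_mk (x y : V) : b.lo s(x, y) = b.level x ⊓ b.level y := rfl

theorem lo_le_hi (f : Sym2 V) : b.lo f ≤ b.hi f := by
  induction f with | _ x y => simp

theorem admissible_scheme (f : Sym2 V) :
    (b.scheme f).Admissible b.scale (b.hi f) (b.lo f) := by
  unfold scheme
  split_ifs <;> simp only [Scheme.Admissible] <;> omega

theorem dense_spec {x y : V} (hS : b.scheme s(x, y) = .dense) (hx : b.level x = b.hi s(x, y)) :
    b.base x + 4 ^ b.scale < b.post x := by
  have hadm := b.admissible_scheme s(x, y)
  rw [hS] at hadm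
  simp only [Scheme.Admissible, hi_mk, lo_mk] at hadm hx
  unfold scheme at hS
  split_ifs at hS with h1 h2 h3
  obtain ⟨w, hw, hl, h⟩ := h3
  rcases Sym2.mem_iff.1 hw with rfl | rfl
  · exact h
  · simp only [hi_mk] at hl
    omega

theorem epoch_spec {x y : V} (hS : b.scheme s(x, y) = .epoch) (hx : b.level x = b.hi s(x, y)) :
    b.post x ≤ b.base x + 4 ^ b.scale := by
  unfold scheme at hS
  split_ifs at hS with h1 h2 h3
  push Not at h3
  exact h3 x (Sym2.mem_mk_left x y) hx

/-! ### No conflicts between batches -/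

/-- What is used about a batch in isolation. -/
structure WellFormed [DecidableEq V] : Prop where
  base_le : ∀ v, b.base v ≤ b.pre v
  post_eq : ∀ v, b.post v = b.pre v + b.edges.countP (v ∈ ·)
  post_le : ∀ v, b.post v ≤ 8 ^ b.scale
  idx_lt : b.idx < 8 ^ b.scale
  nodup : b.edges.Nodup
  not_isDiag : ∀ f ∈ b.edges, ¬ f.IsDiag

/-- What is used about two batches of one stream, where `b` comes before `b'`, if their scales
agree. -/
structure Before (b b' : Batch V) : Prop where
  idx_lt : b.idx < b'.idx
  post_le : ∀ v, b.post v ≤ b'.pre v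
  base_eq : b.idx / 2 ^ b.scale = b'.idx / 2 ^ b.scale → b'.base = b.base
  post_le_base : b.idx / 2 ^ b.scale ≠ b'.idx / 2 ^ b.scale → ∀ v, b.post v ≤ b'.base v

variable [DecidableEq V] {b}

theorem WellFormed.two_pow_level_le (hb : b.WellFormed) {f : Sym2 V} (hf : f ∈ b.edges) {x : V}
    (hx : x ∈ f) : 2 ^ b.level x ≤ b.post x - b.pre x := by
  apply Nat.pow_log_le_self
  rw [hb.post_eq]
  have : 0 < b.edges.countP (x ∈ ·) := List.countP_pos_iff.2 ⟨f, hf, by simpa using hx⟩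
  omega

theorem WellFormed.level_le (hb : b.WellFormed) (v : V) : b.level v ≤ 3 * b.scale := by
  unfold level
  rcases Nat.eq_zero_or_pos (b.post v - b.pre v) with h | h
  · simp [h]
  have h2 := Nat.pow_log_le_self 2 h.ne'
  have h3 := hb.post_le v
  have : 2 ^ Nat.log 2 (b.post v - b.pre v) ≤ 2 ^ (3 * b.scale) := by
    rw [pow_mul]; norm_num; omega
  exact (Nat.pow_le_pow_iff_right (by norm_num)).1 this

theorem WellFormed.hi_le (hb : b.WellFormed) (f : Sym2 V) : b.hi f ≤ 3 * b.scale := by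
  induction f with | _ x y => simp [hb.level_le]

theorem WellFormed.time_lt (hb : b.WellFormed) (S : Scheme) :
    S.time b.scale b.idx < 2 ^ S.timeExp b.scale := by
  have h := hb.idx_lt
  have h8 : 8 ^ b.scale = 2 ^ (2 * b.scale) * 2 ^ b.scale := by
    rw [← pow_add, show 2 * b.scale + b.scale = 3 * b.scale by ring, pow_mul]; norm_num
  cases S <;> simp only [Scheme.time, Scheme.timeExp]
  · rwa [pow_mul]
  · simp
  · rw [Nat.div_lt_iff_lt_mul (by positivity)]; omega
  · exact Nat.mod_lt _ (by positivity)

/-- The clocks fit in their ranges, so that reducing modulo the range loses nothing. -/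
theorem WellFormed.rawClock_lt (hb : b.WellFormed) {x y : V} (hf : s(x, y) ∈ b.edges) :
    b.rawClock (b.scheme s(x, y)) (b.hi s(x, y)) x <
      2 ^ (b.scheme s(x, y)).clockExp b.scale (b.hi s(x, y)) (b.level x) := by
  have h1 := hb.two_pow_level_le hf (Sym2.mem_mk_left x y)
  have h2 := hb.level_le x
  have h3 := hb.post_le x
  have h4 := hb.idx_lt
  have h5 := hb.base_le x
  have hpos : 0 < 2 ^ b.level x := by positivity
  have h8 : 8 ^ b.scale = 2 ^ (2 * b.scale) * 2 ^ b.scale := by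
    rw [← pow_add, show 2 * b.scale + b.scale = 3 * b.scale by ring, pow_mul]; norm_num
  have h4' : 4 ^ b.scale = 2 ^ (2 * b.scale) := by rw [pow_mul]; norm_num
  have hadm := b.admissible_scheme s(x, y)
  rcases hS : b.scheme s(x, y) <;> rw [hS] at hadm <;>
    simp only [rawClock, Scheme.clockExp, Scheme.Admissible] at hadm ⊢
  · simp
  · rw [Nat.div_lt_iff_lt_mul (by positivity), ← pow_add, Nat.sub_add_cancel h2, pow_mul]
    norm_num
    omega
  · split_ifs with hk
    · have h6 := b.epoch_spec hS hk
      rw [Nat.div_lt_iff_lt_mul (by positivity), ← pow_add, Nat.sub_add_cancel (by omega)]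
      omega
    · exact Nat.mod_lt _ (by positivity)
  · split_ifs with hk
    · rw [Nat.div_lt_iff_lt_mul (by positivity), h4', mul_comm]
      omega
    · rw [Nat.div_lt_iff_lt_mul (by positivity)]
      omega

/-- The time named by the color, and the clock of a vertex, determine the batch. -/
theorem rawClock_ne {b b' : Batch V} (hb : b.WellFormed)
    (hlt : b.Before b') (hs : b.scale = b'.scale) {x y : V} (hf : s(x, y) ∈ b.edges)
    (hl : b.level x = b'.level x)
    (ht : (b.scheme s(x, y)).time b.scale b.idx = (b.scheme s(x, y)).time b.scale b'.idx) :
    b.rawClock (b.scheme s(x, y)) (b.hi s(x, y)) x ≠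
      b'.rawClock (b.scheme s(x, y)) (b.hi s(x, y)) x := by
  have h1 := hb.two_pow_level_le hf (Sym2.mem_mk_left x y)
  have h2 := hlt.post_le x
  have h3 := hlt.idx_lt
  have h5 := hb.base_le x
  have hpos : 0 < 2 ^ b.level x := by positivity
  have hdm : ∀ τ, 2 ^ b.scale * (τ / 2 ^ b.scale) + τ % 2 ^ b.scale = τ := fun τ =>
    Nat.div_add_mod _ _
  -- Numbers at a distance of at least `d` have different quotients by `d`.
  have hdiv : ∀ a c d : ℕ, 0 < d → a + d ≤ c → a / d ≠ c / d := fun a c d hd h he => by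
    have := Nat.div_le_div_right (c := d) h
    rw [Nat.add_div_right _ hd] at this
    omega
  have hd1 := hdm b.idx
  have hd2 := hdm b'.idx
  rcases hS' : b.scheme s(x, y) <;> rw [hS'] at ht <;> simp only [Scheme.time] at ht <;>
    simp only [rawClock, ← hl, ← hs]
  · omega
  · exact hdiv _ _ _ hpos (by omega)
  · rw [hlt.base_eq ht]
    split_ifs with hk
    · exact hdiv _ _ _ hpos (by omega)
    · intro he
      rw [ht, he] at hd1
      omega
  · split_ifs with hk
    · have h6 := b.dense_spec hS' hk
      have h7 := hlt.post_le_base (fun he => by rw [ht, he] at hd1; omega) x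
      exact hdiv _ _ _ (by positivity) (by omega)
    · intro he
      rw [ht, he] at hd1
      omega

theorem add_mod_cancel {a c k m : ℕ} (ha : a < m) (hc : c < m) (h : (a + k) % m = (c + k) % m) :
    a = c := by
  have : a ≡ c [MOD m] := Nat.ModEq.add_right_cancel' k h
  rwa [Nat.ModEq, Nat.mod_eq_of_lt ha, Nat.mod_eq_of_lt hc] at this

/-- Edges of different batches that share a vertex get different colors. -/
theorem color_ne_of_before {b b' : Batch V} (hb : b.WellFormed) (hb' : b'.WellFormed)
    (hlt : b.scale = b'.scale → b.Before b') {t ρ ρ' : ℕ} {h : ℕ → V → ℕ × ℕ} {f f' : Sym2 V}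
    (hf : f ∈ b.edges) (hf' : f' ∈ b'.edges) (hw : ∃ w, w ∈ f ∧ w ∈ f')
    (hg : b.Good t ρ (h ρ) f) : b.color t ρ (h ρ) f ≠ b'.color t ρ' (h ρ') f' := by
  intro heq
  obtain ⟨x, hx, hx'⟩ := hw
  obtain ⟨y, rfl⟩ := Sym2.mem_iff_exists.1 hx
  obtain ⟨y', rfl⟩ := Sym2.mem_iff_exists.1 hx'
  simp only [color, Prod.mk.injEq] at heq
  obtain ⟨⟨rfl, hs, hhi, hlo, hS, ht⟩, hat, -⟩ := heq
  simp only [Sym2.map_mk, Sym2.eq_iff] at hat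
  have hlt := hlt hs
  have key : b.attr t (h ρ) (b.scheme s(x, y)) (b.hi s(x, y)) x =
      b'.attr t (h ρ) (b'.scheme s(x, y')) (b'.hi s(x, y')) x := by
    rcases hat with ⟨h1, -⟩ | ⟨h1, h2⟩
    · exact h1
    · exfalso
      apply hg.1 x y rfl
      simp only [attr, Prod.mk.injEq] at h2
      exact h2.1.symm
  simp only [attr, clock, Prod.mk.injEq] at key
  obtain ⟨-, hl, hc⟩ := key
  have r1 := hb.rawClock_lt hf
  have r2 := hb'.rawClock_lt hf'
  rw [← hS, ← hhi, ← hl, ← hs] at r2 hc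
  rw [← hS, ← hs] at ht
  exact rawClock_ne hb hlt hs hf hl ht (add_mod_cancel r1 r2 hc)

end Batch

/-! ### Few hash functions fail to color an edge -/

theorem card_residue_le (N m c d : ℕ) :
    (Finset.univ.filter fun a : Fin N => (c + a) % m = d).card ≤ N / m + 1 := by
  rw [← Finset.card_range (N / m + 1)]
  refine Finset.card_le_card_of_injOn (fun a => (a : ℕ) / m) (fun a _ => ?_) ?_
  · simp only [Finset.coe_range, Set.mem_Iio]
    exact Nat.lt_succ_of_le (Nat.div_le_div_right a.2.le)
  · intro a ha a' ha' h
    simp only [Finset.coe_filter, Finset.mem_univ, true_and, Set.mem_ofPred_eq] at ha ha' h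
    have h1 : (a : ℕ) ≡ a' [MOD m] := Nat.ModEq.add_left_cancel' c (ha.trans ha'.symm)
    have h2 := Nat.div_add_mod (a : ℕ) m
    have h3 := Nat.div_add_mod (a' : ℕ) m
    rw [h, h1] at h2
    exact Fin.ext (h2.symm.trans h3)

/-- To bound the fraction of functions with a property, it is enough to vary one value. -/
theorem card_filter_mul_le_of_update {V A : Type} [Fintype V]
    [DecidableEq V] [Fintype A] (y : V)
    (Q : (V → A) → Prop) [DecidablePred Q] (B : ℕ)
    (hB : ∀ h, (Finset.univ.filter fun a => Q (Function.update h y a)).card ≤ B) :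
    (Finset.univ.filter Q).card * Fintype.card A ≤ B * Fintype.card (V → A) := by
  have h1 : (Finset.univ.filter fun p : (V → A) × A => Q p.1).card =
      (Finset.univ.filter Q).card * Fintype.card A := by
    rw [← Finset.card_univ, ← Finset.card_product]
    congr 1
    ext p
    simp
  -- Exchanging the value at `y` with the extra coordinate is an involution.
  have h2 : (Finset.univ.filter fun p : (V → A) × A => Q p.1).card ≤
      (Finset.univ.filter fun p : (V → A) × A => Q (Function.update p.1 y p.2)).card := by
    refine Finset.card_le_card_of_injOn (fun p => (Function.update p.1 y p.2, p.1 y)) ?_ ?_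
    · intro p hp
      simpa using hp
    · rintro ⟨h, a⟩ - ⟨h', a'⟩ - he
      simp only [Prod.mk.injEq] at he
      obtain ⟨he1, he2⟩ := he
      have ha : a = a' := by simpa using congrFun he1 y
      have hh : h = h' := by
        funext v
        by_cases hv : v = y
        · rw [hv, he2]
        · simpa [hv] using congrFun he1 v
      rw [ha, hh]
  have h3 : (Finset.univ.filter fun p : (V → A) × A => Q (Function.update p.1 y p.2)).card =
      ∑ h : V → A, (Finset.univ.filter fun a => Q (Function.update h y a)).card := by
    simp only [Finset.card_filter]
    rw [Fintype.sum_prod_type]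
  rw [← h1]
  calc _ ≤ _ := h2
    _ = _ := h3
    _ ≤ ∑ _h : V → A, B := Finset.sum_le_sum fun h _ => hB h
    _ = _ := by simp [mul_comm]

/-- The hash values given by a seed. -/
def hashValue {V : Type} {N : ℕ} (h : V → Fin N × Fin N) (v : V) : ℕ × ℕ := ((h v).1, (h v).2)

theorem card_residue_pair_le (N m z c d c' d' : ℕ) :
    (Finset.univ.filter fun a : Fin N × Fin N =>
      (c + a.1) % m = d ∧ (c' + a.2) % z = d').card ≤ (N / m + 1) * (N / z + 1) := by
  have : (Finset.univ.filter fun a : Fin N × Fin N => (c + a.1) % m = d ∧ (c' + a.2) % z = d') =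
      (Finset.univ.filter fun a : Fin N => (c + a) % m = d) ×ˢ
        (Finset.univ.filter fun a : Fin N => (c' + a) % z = d') := by
    ext a
    simp
  rw [this, Finset.card_product]
  exact Nat.mul_le_mul (card_residue_le ..) (card_residue_le ..)

namespace Batch

variable {V : Type} [Fintype V] [DecidableEq V] {b : Batch V}

open scoped Classical in
theorem card_side_eq_mul_le {N t : ℕ} {x y : V} (hxy : x ≠ y) :
    (Finset.univ.filter fun h : V → Fin N × Fin N =>
      side t (hashValue h) x = side t (hashValue h) y).card * (N * N) ≤
      (N / 2 ^ 0 + 1) * (N / 2 ^ t + 1) * Fintype.card (V → Fin N × Fin N) := by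
  have := card_filter_mul_le_of_update (A := Fin N × Fin N) y
    (fun h => side t (hashValue h) x = side t (hashValue h) y)
    ((N / 2 ^ 0 + 1) * (N / 2 ^ t + 1)) ?_
  · simpa using this
  intro h
  refine (Finset.card_le_card ?_).trans (card_residue_pair_le N (2 ^ 0) (2 ^ t) 0 0 0
    (side t (hashValue h) x))
  intro a ha
  simp only [Finset.mem_filter, Finset.mem_univ, true_and, side, hashValue,
    Function.update_self, Function.update_of_ne hxy] at ha ⊢
  simp [Nat.mod_one, ha]

open scoped Classical in
/-- The hash functions for which two edges with a common endpoint get the same color. -/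
theorem card_color_eq_mul_le {N t ρ : ℕ} {x y y' : V} (hxy : x ≠ y) (hyy : y' ≠ y) :
    (Finset.univ.filter fun h : V → Fin N × Fin N =>
      b.color t ρ (hashValue h) s(x, y') = b.color t ρ (hashValue h) s(x, y)).card * (N * N) ≤
      (N / 2 ^ (b.scheme s(x, y)).clockExp b.scale (b.hi s(x, y)) (b.level y) + 1) *
        (N / 2 ^ ((b.scheme s(x, y)).hashExp b.scale (b.hi s(x, y)) (b.lo s(x, y)) + t) + 1) *
        Fintype.card (V → Fin N × Fin N) := by
  have := card_filter_mul_le_of_update (A := Fin N × Fin N) y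
    (fun h => b.color t ρ (hashValue h) s(x, y') = b.color t ρ (hashValue h) s(x, y))
    ((N / 2 ^ (b.scheme s(x, y)).clockExp b.scale (b.hi s(x, y)) (b.level y) + 1) *
        (N / 2 ^ ((b.scheme s(x, y)).hashExp b.scale (b.hi s(x, y)) (b.lo s(x, y)) + t) + 1)) ?_
  · simpa using this
  intro h
  refine (Finset.card_le_card ?_).trans (card_residue_pair_le N _ _
    (b.rawClock (b.scheme s(x, y)) (b.hi s(x, y)) y)
    (b.clock (hashValue h) (b.scheme s(x, y)) (b.hi s(x, y)) y')
    (h x).2 (hash (hashValue h)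
      ((b.scheme s(x, y)).hashExp b.scale (b.hi s(x, y)) (b.lo s(x, y)) + t) s(x, y')))
  intro a ha
  simp only [Finset.mem_filter, Finset.mem_univ, true_and, color, Prod.mk.injEq] at ha ⊢
  obtain ⟨⟨hhi, hlo, hS, -⟩, hat, hha⟩ := ha
  rw [hhi, hlo, hS] at hha
  rw [hS, hhi, Sym2.map_mk, Sym2.map_mk] at hat
  -- The common endpoint has the same attribute in both edges.
  rw [Sym2.congr_right] at hat
  simp only [attr, Prod.mk.injEq] at hat
  obtain ⟨-, -, hc⟩ := hat
  simp only [clock, hashValue, Function.update_self, Function.update_of_ne hyy] at hc ⊢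
  simp only [hash, Sym2.lift_mk, hashValue, Function.update_self, Function.update_of_ne hyy,
    Function.update_of_ne hxy] at hha ⊢
  exact ⟨hc.symm, hha.symm⟩

theorem div_add_one_mul_le {N m z : ℕ} (hm : m ≤ 128 * N) (hz : z ≤ 128 * N) (hm0 : 0 < m)
    (hz0 : 0 < z) :
    (((N / m + 1) * (N / z + 1) : ℕ) : ℝ) ≤ 129 ^ 2 * (N * N) / (m * z) := by
  have key : ∀ k : ℕ, 0 < k → k ≤ 128 * N → ((N / k + 1 : ℕ) : ℝ) ≤ 129 * N / k := by
    intro k hk h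
    have h1 : ((N / k : ℕ) : ℝ) ≤ N / k := Nat.cast_div_le
    have h2 : (1 : ℝ) ≤ 128 * N / k := by
      rw [le_div_iff₀ (by exact_mod_cast hk), one_mul]
      exact_mod_cast h
    push_cast
    calc ((N / k : ℕ) : ℝ) + 1 ≤ N / k + 128 * N / k := add_le_add h1 h2
      _ = _ := by ring
  push_cast
  calc (((N / m : ℕ) : ℝ) + 1) * (((N / z : ℕ) : ℝ) + 1) ≤ (129 * N / m) * (129 * N / z) := by
        have h1 := key m hm0 hm
        have h2 := key z hz0 hz
        push_cast at h1 h2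
        gcongr
    _ = _ := by ring

/-- A set of hash functions that leaves at most `(N / m + 1) * (N / z + 1)` of the `N * N` values at
one vertex has probability at most `129 ^ 2 / (m * z)`. -/
theorem card_le_of_card_mul_le {N m z B H : ℕ} (hN : 0 < N) (hm : m ≤ 128 * N)
    (hz : z ≤ 128 * N) (hm0 : 0 < m) (hz0 : 0 < z)
    (h : B * (N * N) ≤ (N / m + 1) * (N / z + 1) * H) :
    (B : ℝ) ≤ 129 ^ 2 / (m * z) * H := by
  have h1 := div_add_one_mul_le hm hz hm0 hz0
  have hN' : (0 : ℝ) < N * N := by positivity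
  have h2 : (B : ℝ) * (N * N) ≤ ((N / m + 1) * (N / z + 1) : ℕ) * H := by exact_mod_cast h
  have h3 : (B : ℝ) * (N * N) ≤ 129 ^ 2 * (N * N) / (m * z) * H :=
    h2.trans (by gcongr)
  refine le_of_mul_le_mul_right (h3.trans_eq ?_) hN'
  ring

open scoped Classical in
/-- Collisions at the endpoint `x` of an edge. -/
theorem WellFormed.card_collision_le (hb : b.WellFormed) {N t ρ : ℕ} (hN : 0 < N)
    (hs : 64 ^ b.scale ≤ 64 * N) (ht : t ≤ b.scale + 1) {x y : V} (hf : s(x, y) ∈ b.edges) :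
    ((Finset.univ.filter fun h : V → Fin N × Fin N => ∃ f' ∈ b.edges, f' ≠ s(x, y) ∧ x ∈ f' ∧
      b.color t ρ (hashValue h) f' = b.color t ρ (hashValue h) s(x, y)).card : ℝ) ≤
      2 * 129 ^ 2 / 2 ^ t * Fintype.card (V → Fin N × Fin N) := by
  have hxy : x ≠ y := fun h => hb.not_isDiag _ hf (by simp [h])
  set S := b.scheme s(x, y)
  set i := b.scale with hi
  set m := 2 ^ S.clockExp i (b.hi s(x, y)) (b.level y)
  set z := 2 ^ (S.hashExp i (b.hi s(x, y)) (b.lo s(x, y)) + t)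
  have hpow : ∀ e, e ≤ 4 * i + 1 → 2 ^ e ≤ 128 * N := by
    intro e he
    calc 2 ^ e ≤ 2 ^ (6 * i + 1) := Nat.pow_le_pow_right (by norm_num) (by omega)
      _ = 2 * 64 ^ i := by rw [pow_succ, pow_mul]; ring
      _ ≤ _ := by omega
  have hm : m ≤ 128 * N := hpow _ (by have := S.clockExp_le (i := i) (hi := b.hi s(x, y))
                                        (k := b.level y); omega)
  have hz : z ≤ 128 * N := hpow _ (by
    have : S.hashExp i _ _ ≤ 3 * i := Scheme.hashExp_le (b.lo_le_hi s(x, y)) (hb.hi_le s(x, y))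
    omega)
  have hmz : 2 ^ (b.level x + t) ≤ m * z := by
    rw [← pow_add, ← add_assoc]
    exact Nat.pow_le_pow_right (by norm_num) (Nat.add_le_add_right
      (Scheme.level_le_clockExp_add (b.admissible_scheme s(x, y)) (hb.hi_le _) rfl rfl) t)
  set F := b.edges.toFinset.filter (x ∈ ·)
  have hF : F.card ≤ 2 ^ (b.level x + 1) := by
    have h1 : F.card = b.edges.countP (x ∈ ·) := by
      rw [List.countP_eq_length_filter, ← List.toFinset_card_of_nodup (hb.nodup.filter _),
        List.toFinset_filter]
      simp [F]
    have h2 := hb.post_eq x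
    have h3 := Nat.lt_pow_succ_log_self (b := 2) (by norm_num) (b.post x - b.pre x)
    unfold level
    omega
  have hsub : (Finset.univ.filter fun h : V → Fin N × Fin N => ∃ f' ∈ b.edges, f' ≠ s(x, y) ∧
      x ∈ f' ∧ b.color t ρ (hashValue h) f' = b.color t ρ (hashValue h) s(x, y)) ⊆
      F.biUnion fun f' => Finset.univ.filter fun h => f' ≠ s(x, y) ∧
        b.color t ρ (hashValue h) f' = b.color t ρ (hashValue h) s(x, y) := by
    intro h hh
    simp only [Finset.mem_filter, Finset.mem_univ, true_and, Finset.mem_biUnion, F,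
      List.mem_toFinset] at hh ⊢
    obtain ⟨f', h1, h2, h3, h4⟩ := hh
    exact ⟨f', ⟨h1, h3⟩, h2, h4⟩
  have hone : ∀ f' ∈ F, ((Finset.univ.filter fun h : V → Fin N × Fin N => f' ≠ s(x, y) ∧
        b.color t ρ (hashValue h) f' = b.color t ρ (hashValue h) s(x, y)).card : ℝ) ≤
      129 ^ 2 / (m * z : ℕ) * Fintype.card (V → Fin N × Fin N) := by
    intro f' hf'
    obtain ⟨y', rfl⟩ := Sym2.mem_iff_exists.1 (Finset.mem_filter.1 hf').2
    by_cases hy : y' = y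
    · simp only [hy, ne_eq, not_true_eq_false, false_and, Finset.filter_false, Finset.card_empty,
        Nat.cast_zero]
      positivity
    · push_cast
      refine le_trans ?_ (card_le_of_card_mul_le hN hm hz (by positivity) (by positivity)
        (card_color_eq_mul_le (ρ := ρ) hxy hy))
      gcongr
      tauto
  have hmz' : (2 : ℝ) ^ (b.level x + t) ≤ (m * z : ℕ) := by exact_mod_cast hmz
  calc _ ≤ ∑ f' ∈ F, ((Finset.univ.filter fun h : V → Fin N × Fin N => f' ≠ s(x, y) ∧
        b.color t ρ (hashValue h) f' = b.color t ρ (hashValue h) s(x, y)).card : ℝ) := by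
        exact_mod_cast (Finset.card_le_card hsub).trans Finset.card_biUnion_le
    _ ≤ ∑ _f' ∈ F, 129 ^ 2 / ((m * z : ℕ) : ℝ) * Fintype.card (V → Fin N × Fin N) :=
        Finset.sum_le_sum hone
    _ = F.card * (129 ^ 2 / ((m * z : ℕ) : ℝ) * Fintype.card (V → Fin N × Fin N)) := by
        rw [Finset.sum_const, nsmul_eq_mul]
    _ ≤ 2 ^ (b.level x + 1) *
          (129 ^ 2 / 2 ^ (b.level x + t) * Fintype.card (V → Fin N × Fin N)) := by
        gcongr
        exact_mod_cast hF
    _ = _ := by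
        rw [pow_add, pow_add]
        field_simp

open scoped Classical in
/-- An edge is not good in a round only with probability `O(2 ^ (-t))`. -/
theorem WellFormed.card_not_good_le (hb : b.WellFormed) {N t ρ : ℕ} (hN : 0 < N)
    (hs : 64 ^ b.scale ≤ 64 * N) (ht : t ≤ b.scale + 1) {f : Sym2 V} (hf : f ∈ b.edges) :
    ((Finset.univ.filter fun h : V → Fin N × Fin N => ¬ b.Good t ρ (hashValue h) f).card : ℝ) ≤
      2 ^ 17 / 2 ^ t * Fintype.card (V → Fin N × Fin N) := by
  induction f with | _ x y
  have hxy : x ≠ y := fun h => hb.not_isDiag _ hf (by simp [h])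
  have h0 : (2 : ℕ) ^ t ≤ 128 * N := by
    calc 2 ^ t ≤ 2 ^ (6 * b.scale + 1) := Nat.pow_le_pow_right (by norm_num) (by omega)
      _ = 2 * 64 ^ b.scale := by rw [pow_succ, pow_mul]; ring
      _ ≤ _ := by omega
  have h1 := card_le_of_card_mul_le hN (by omega : 2 ^ 0 ≤ 128 * N) h0 (by positivity)
    (by positivity) (card_side_eq_mul_le hxy)
  have h2 := hb.card_collision_le (ρ := ρ) hN hs ht hf
  have h3 := hb.card_collision_le (ρ := ρ) hN hs ht (Sym2.eq_swap ▸ hf : s(y, x) ∈ b.edges)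
  rw [Sym2.eq_swap (a := y)] at h3
  have hsub : (Finset.univ.filter fun h : V → Fin N × Fin N =>
      ¬ b.Good t ρ (hashValue h) s(x, y)) ⊆
      ((Finset.univ.filter fun h : V → Fin N × Fin N =>
        side t (hashValue h) x = side t (hashValue h) y) ∪
      (Finset.univ.filter fun h : V → Fin N × Fin N => ∃ f' ∈ b.edges, f' ≠ s(x, y) ∧ x ∈ f' ∧
        b.color t ρ (hashValue h) f' = b.color t ρ (hashValue h) s(x, y))) ∪
      (Finset.univ.filter fun h : V → Fin N × Fin N => ∃ f' ∈ b.edges, f' ≠ s(x, y) ∧ y ∈ f' ∧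
        b.color t ρ (hashValue h) f' = b.color t ρ (hashValue h) s(x, y)) := by
    intro h hh
    simp only [Finset.mem_filter, Finset.mem_univ, true_and, Finset.mem_union] at hh ⊢
    by_contra hc
    push Not at hc
    obtain ⟨⟨hc1, hc2⟩, hc3⟩ := hc
    refine hh ⟨fun x' y' he => ?_, fun f' hf' hne ⟨w, hw, hw'⟩ => ?_⟩
    · rcases Sym2.eq_iff.1 he with ⟨rfl, rfl⟩ | ⟨rfl, rfl⟩
      · exact hc1
      · exact hc1.symm
    · rcases Sym2.mem_iff.1 hw with rfl | rfl
      · exact hc2 f' hf' hne hw'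
      · exact hc3 f' hf' hne hw'
  have h4 := (Finset.card_le_card hsub).trans ((Finset.card_union_le _ _).trans
    (Nat.add_le_add_right (Finset.card_union_le _ _) _))
  have h5 := (Nat.cast_le (α := ℝ)).2 h4
  push_cast at h5
  refine h5.trans ((add_le_add (add_le_add h1 h2) h3).trans ?_)
  rw [← add_mul, ← add_mul]
  refine mul_le_mul_of_nonneg_right ?_ (by positivity)
  push_cast
  rw [one_mul, ← add_div, ← add_div]
  gcongr
  norm_num

open scoped Classical in
/-- An edge is not good in any of `R` rounds only with probability `O(2 ^ (-t)) ^ R`. -/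
theorem WellFormed.card_forall_not_good_le (hb : b.WellFormed) {N t : ℕ} (R : ℕ) (hN : 0 < N)
    (hs : 64 ^ b.scale ≤ 64 * N) (ht : t ≤ b.scale + 1) {f : Sym2 V} (hf : f ∈ b.edges) :
    ((Finset.univ.filter fun ω : Fin R → V → Fin N × Fin N =>
      ∀ ρ : Fin R, ¬ b.Good t ρ (hashValue (ω ρ)) f).card : ℝ) ≤
      (2 ^ 17 / 2 ^ t) ^ R * Fintype.card (Fin R → V → Fin N × Fin N) := by
  have : (Finset.univ.filter fun ω : Fin R → V → Fin N × Fin N =>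
      ∀ ρ : Fin R, ¬ b.Good t ρ (hashValue (ω ρ)) f) =
      Fintype.piFinset fun ρ : Fin R =>
        Finset.univ.filter fun h => ¬ b.Good t ρ (hashValue h) f := by
    ext ω
    simp
  rw [this, Fintype.card_piFinset]
  push_cast
  refine (Finset.prod_le_prod (fun _ _ => by positivity) fun (ρ : Fin R) _ =>
    hb.card_not_good_le (ρ := (ρ : ℕ)) hN hs ht hf).trans_eq ?_
  simp [mul_pow, div_pow]

end Batch

/-! ### The batches of a stream -/

variable {n : ℕ}

/-- The number of edges of a list at a vertex. -/
def degIn (l : List (Sym2 (Fin n))) (v : Fin n) : ℕ := l.countP (v ∈ ·)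

/-- The least `i` such that all values of `d` are at most `8 ^ i`. -/
def scaleOf (d : Fin n → ℕ) : ℕ := Nat.clog 8 (Finset.univ.sup d)

/-- The batch number `τ`, from its edges, the degrees after it, and the degrees at the start of the
epoch of the preceding batch. The scale of the preceding batch is that of the degrees before this
batch. For `τ = 0` both alternatives for the base vanish, so it does not matter that
`τ - 1 = 0`. -/
def mkBatch (τ : ℕ) (edges : List (Sym2 (Fin n))) (post prevBase : Fin n → ℕ) : Batch (Fin n) where
  idx := τ
  scale := scaleOf post
  pre v := post v - degIn edges v
  post := post
  base :=
    if scaleOf (fun v => post v - degIn edges v) = scaleOf post ∧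
        (τ - 1) / 2 ^ scaleOf post = τ / 2 ^ scaleOf post then prevBase
    else fun v => post v - degIn edges v
  edges := edges

/-- The edges of the batch number `τ`; every batch has `n` edges. -/
def batchEdges (es : List (Sym2 (Fin n))) (τ : ℕ) : List (Sym2 (Fin n)) :=
  (es.drop (τ * n)).take n

/-- The degrees at the start of the epoch of the last batch before the batch number `τ`. -/
def prevBase (es : List (Sym2 (Fin n))) : ℕ → Fin n → ℕ
  | 0 => fun _ => 0
  | τ + 1 => (mkBatch τ (batchEdges es τ) (degIn (es.take ((τ + 1) * n))) (prevBase es τ)).base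

/-- The batch number `τ` of a stream. -/
def batchAt (es : List (Sym2 (Fin n))) (τ : ℕ) : Batch (Fin n) :=
  mkBatch τ (batchEdges es τ) (degIn (es.take ((τ + 1) * n))) (prevBase es τ)

/-- A stream of different edges without loops. -/
structure IsSimpleStream (es : List (Sym2 (Fin n))) : Prop where
  nodup : es.Nodup
  not_isDiag : ∀ f ∈ es, ¬ f.IsDiag
  degIn_lt : ∀ v, degIn es v < n

theorem degIn_append (l l' : List (Sym2 (Fin n))) (v : Fin n) :
    degIn (l ++ l') v = degIn l v + degIn l' v := List.countP_append ..

theorem degIn_take_mono (es : List (Sym2 (Fin n))) {k k' : ℕ} (h : k ≤ k') (v : Fin n) :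
    degIn (es.take k) v ≤ degIn (es.take k') v :=
  (List.take_sublist_take_left h).countP_le

theorem degIn_take_le (es : List (Sym2 (Fin n))) (k : ℕ) (v : Fin n) :
    degIn (es.take k) v ≤ degIn es v :=
  (List.take_sublist k es).countP_le

theorem degIn_take_add (es : List (Sym2 (Fin n))) (τ : ℕ) (v : Fin n) :
    degIn (es.take ((τ + 1) * n)) v = degIn (es.take (τ * n)) v + degIn (batchEdges es τ) v := by
  rw [add_mul, one_mul, List.take_add, degIn_append, batchEdges]

theorem sum_degIn {l : List (Sym2 (Fin n))} (hl : ∀ f ∈ l, ¬ f.IsDiag) :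
    ∑ v, degIn l v = 2 * l.length := by
  induction l with
  | nil => simp [degIn]
  | cons e l ih =>
    have h1 := ih fun f hf => hl f (List.mem_cons_of_mem _ hf)
    have h2 : ∑ v : Fin n, (if v ∈ e then 1 else 0) = 2 := by
      have he := hl e List.mem_cons_self
      induction e with | _ x y
      have hxy : x ≠ y := by simpa using he
      rw [← Finset.card_filter, ← Finset.card_pair hxy]
      congr 1
      ext v
      simp
    simp only [degIn, List.countP_cons, Finset.sum_add_distrib, List.length_cons,
      decide_eq_true_eq] at *
    rw [h1, h2]
    ring

theorem scaleOf_mono {d d' : Fin n → ℕ} (h : ∀ v, d v ≤ d' v) : scaleOf d ≤ scaleOf d' :=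
  Nat.clog_mono_right 8 (Finset.sup_mono_fun fun v _ => h v)

theorem le_pow_scaleOf (d : Fin n → ℕ) (v : Fin n) : d v ≤ 8 ^ scaleOf d :=
  (Finset.le_sup (f := d) (Finset.mem_univ v)).trans (Nat.le_pow_clog (by norm_num) _)

theorem scaleOf_le {d : Fin n → ℕ} {D : ℕ} (h : ∀ v, d v ≤ D) : scaleOf d ≤ Nat.clog 8 D :=
  Nat.clog_mono_right 8 (Finset.sup_le fun v _ => h v)

theorem eight_pow_clog_le {D : ℕ} (hD : 0 < D) : 8 ^ Nat.clog 8 D ≤ 8 * D := by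
  rcases Nat.eq_zero_or_pos (Nat.clog 8 D) with h0 | h0
  · rw [h0]; omega
  have h1 : 1 < D := by
    by_contra hc
    exact h0.ne' (Nat.clog_of_right_le_one (by omega) 8)
  have h2 := Nat.pow_pred_clog_lt_self (b := 8) (by norm_num) h1
  rw [← Nat.succ_pred_eq_of_pos h0, pow_succ]
  omega

section batchAt

variable (es : List (Sym2 (Fin n))) (τ : ℕ)

@[simp] theorem batchAt_idx : (batchAt es τ).idx = τ := rfl

@[simp] theorem batchAt_edges : (batchAt es τ).edges = batchEdges es τ := rfl

theorem batchAt_post : (batchAt es τ).post = degIn (es.take ((τ + 1) * n)) := rfl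

theorem batchAt_scale : (batchAt es τ).scale = scaleOf (degIn (es.take ((τ + 1) * n))) := rfl

theorem batchAt_pre : (batchAt es τ).pre = degIn (es.take (τ * n)) := by
  funext v
  change degIn (es.take ((τ + 1) * n)) v - degIn (batchEdges es τ) v = _
  rw [degIn_take_add]
  omega

theorem batchAt_base_zero (v : Fin n) : (batchAt es 0).base v = 0 := by
  have h := congrFun (batchAt_pre es 0) v
  simp only [zero_mul, List.take_zero] at h
  change (ite _ _ _ : Fin n → ℕ) v = 0
  split_ifs
  · rfl
  · exact h

theorem batchAt_base_succ : (batchAt es (τ + 1)).base =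
    if (batchAt es τ).scale = (batchAt es (τ + 1)).scale ∧
      τ / 2 ^ (batchAt es (τ + 1)).scale = (τ + 1) / 2 ^ (batchAt es (τ + 1)).scale
    then (batchAt es τ).base else (batchAt es (τ + 1)).pre := by
  rw [batchAt_scale es τ, ← batchAt_pre es (τ + 1)]
  rfl

variable {es} {τ}

theorem batchAt_scale_mono {τ' : ℕ} (h : τ ≤ τ') :
    (batchAt es τ).scale ≤ (batchAt es τ').scale :=
  scaleOf_mono fun v => degIn_take_mono es (Nat.mul_le_mul_right n (by omega)) v

theorem batchAt_post_le_pre {τ' : ℕ} (h : τ < τ') (v : Fin n) :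
    (batchAt es τ).post v ≤ (batchAt es τ').pre v := by
  rw [batchAt_post, batchAt_pre]
  exact degIn_take_mono es (Nat.mul_le_mul_right n h) v

theorem batchAt_pre_le_post (v : Fin n) : (batchAt es τ).pre v ≤ (batchAt es τ).post v := by
  rw [batchAt_post, batchAt_pre]
  exact degIn_take_mono es (Nat.mul_le_mul_right n (by omega)) v

theorem batchAt_base_le (v : Fin n) : (batchAt es τ).base v ≤ (batchAt es τ).pre v := by
  induction τ with
  | zero => rw [batchAt_base_zero]; exact Nat.zero_le _
  | succ τ ih =>
    rw [batchAt_base_succ]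
    split_ifs
    · exact ih.trans ((batchAt_pre_le_post v).trans (batchAt_post_le_pre (Nat.lt_succ_self τ) v))
    · exact le_rfl

/-- The degrees at the start of an epoch are the same for all batches of the epoch. -/
theorem batchAt_base_eq {τ' : ℕ} (h : τ ≤ τ')
    (hs : (batchAt es τ).scale = (batchAt es τ').scale)
    (he : τ / 2 ^ (batchAt es τ).scale = τ' / 2 ^ (batchAt es τ).scale) :
    (batchAt es τ').base = (batchAt es τ).base := by
  induction τ', h using Nat.le_induction with
  | base => rfl
  | succ τ' h ih =>
    have h1 := batchAt_scale_mono (es := es) h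
    have h2 : (batchAt es τ').scale ≤ (batchAt es (τ' + 1)).scale :=
      batchAt_scale_mono (Nat.le_succ τ')
    have h3 : (batchAt es τ).scale = (batchAt es τ').scale := by omega
    have h4 : τ / 2 ^ (batchAt es τ).scale ≤ τ' / 2 ^ (batchAt es τ).scale :=
      Nat.div_le_div_right h
    have h5 : τ' / 2 ^ (batchAt es τ).scale ≤ (τ' + 1) / 2 ^ (batchAt es τ).scale :=
      Nat.div_le_div_right (Nat.le_succ τ')
    rw [batchAt_base_succ, if_pos ⟨by omega, by rw [← hs]; omega⟩]
    exact ih h3 (by omega)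

/-- All batches of an earlier epoch of the same scale lie before the start of an epoch. -/
theorem batchAt_post_le_base {τ' : ℕ} (h : τ ≤ τ')
    (hs : (batchAt es τ).scale = (batchAt es τ').scale)
    (he : τ / 2 ^ (batchAt es τ).scale ≠ τ' / 2 ^ (batchAt es τ).scale) (v : Fin n) :
    (batchAt es τ).post v ≤ (batchAt es τ').base v := by
  induction τ', h using Nat.le_induction with
  | base => exact absurd rfl he
  | succ τ' h ih =>
    have h1 := batchAt_scale_mono (es := es) h
    have h2 : (batchAt es τ').scale ≤ (batchAt es (τ' + 1)).scale :=
      batchAt_scale_mono (Nat.le_succ τ')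
    have h3 : (batchAt es τ).scale = (batchAt es τ').scale := by omega
    rw [batchAt_base_succ]
    split_ifs with hc
    · rw [← hs] at hc
      exact ih h3 (by rw [hc.2]; exact he)
    · exact batchAt_post_le_pre (by omega) v

theorem batchAt_scale_le {D : ℕ} (hd : ∀ v, degIn es v ≤ D) :
    (batchAt es τ).scale ≤ Nat.clog 8 D :=
  scaleOf_le fun v => (degIn_take_le es _ v).trans (hd v)

theorem batchAt_before {τ' : ℕ} (h : τ < τ') (hs : (batchAt es τ).scale = (batchAt es τ').scale) :
    (batchAt es τ).Before (batchAt es τ') where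
  idx_lt := h
  post_le := batchAt_post_le_pre h
  base_eq := batchAt_base_eq h.le hs
  post_le_base := batchAt_post_le_base h.le hs

end batchAt

namespace IsSimpleStream

variable {es : List (Sym2 (Fin n))} {τ : ℕ}

theorem mul_le_length (h : τ < es.length / n) : (τ + 1) * n ≤ es.length :=
  (Nat.mul_le_mul_right n h).trans (Nat.div_mul_le_self _ _)

/-- Every batch adds `2 * n` to the sum of the degrees, so the scale bounds the number of
batches. -/
theorem two_mul_le_pow_scale (h : IsSimpleStream es) (hτ : τ < es.length / n) :
    2 * (τ + 1) ≤ 8 ^ (batchAt es τ).scale := by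
  have hn : 0 < n := Nat.pos_of_ne_zero fun h0 => by simp [h0] at hτ
  have h1 : ∑ v, degIn (es.take ((τ + 1) * n)) v = 2 * ((τ + 1) * n) := by
    rw [sum_degIn fun f hf => h.not_isDiag f (List.mem_of_mem_take hf), List.length_take,
      min_eq_left (mul_le_length hτ)]
  have h2 : ∑ v, degIn (es.take ((τ + 1) * n)) v ≤ ∑ _v : Fin n, 8 ^ (batchAt es τ).scale :=
    Finset.sum_le_sum fun v _ => le_pow_scaleOf _ v
  rw [h1] at h2
  simp only [Finset.sum_const, Finset.card_univ, Fintype.card_fin, smul_eq_mul] at h2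
  refine Nat.le_of_mul_le_mul_left ?_ hn
  linarith

theorem batchEdges_sublist : (batchEdges es τ).Sublist es :=
  (List.take_sublist _ _).trans (List.drop_sublist _ _)

theorem wellFormed (h : IsSimpleStream es) (hτ : τ < es.length / n) :
    (batchAt es τ).WellFormed where
  base_le := batchAt_base_le
  post_eq v := by
    rw [batchAt_post, batchAt_pre]
    exact degIn_take_add es τ v
  post_le := le_pow_scaleOf _
  idx_lt := by have := h.two_mul_le_pow_scale hτ; simp only [batchAt_idx]; omega
  nodup := h.nodup.sublist batchEdges_sublist
  not_isDiag f hf := h.not_isDiag f (batchEdges_sublist.subset hf)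

end IsSimpleStream

/-! ### Greedy edge coloring -/

/-- Edges of a list with a common endpoint get different colors. -/
def IsProperOn (l : List (Sym2 (Fin n))) (c : Sym2 (Fin n) → ℕ) : Prop :=
  ∀ f ∈ l, ∀ f' ∈ l, f ≠ f' → (∃ v, v ∈ f ∧ v ∈ f') → c f ≠ c f'

theorem exists_isProperOn (l : List (Sym2 (Fin n))) :
    ∃ c, IsProperOn l c ∧ ∀ f ∈ l, c f < 2 * Finset.univ.sup (degIn l) := by
  suffices h : ∀ d, (∀ v, degIn l v ≤ d) → ∃ c, IsProperOn l c ∧ ∀ f ∈ l, c f < 2 * d from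
    h _ fun v => Finset.le_sup (Finset.mem_univ v)
  intro d hd
  induction l with
  | nil => exact ⟨fun _ => 0, by simp [IsProperOn], by simp⟩
  | cons e l ih =>
    have hcons : ∀ v, degIn (e :: l) v = degIn l v + if v ∈ e then 1 else 0 := fun v => by
      simp [degIn, List.countP_cons]
    obtain ⟨c, hc, hlt⟩ := ih fun v => by have := hd v; rw [hcons] at this; omega
    by_cases he : e ∈ l
    · have hsub : ∀ f ∈ e :: l, f ∈ l := by simp [he]
      exact ⟨c, fun f hf f' hf' => hc f (hsub f hf) f' (hsub f' hf'),
        fun f hf => hlt f (hsub f hf)⟩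
    induction e with | _ x y
    -- The colors of the edges of `l` at `x` or at `y` are forbidden.
    set F := (l.filter fun f => x ∈ f) ++ (l.filter fun f => y ∈ f)
    have hF : (F.map c).toFinset.card < 2 * d := by
      refine (List.toFinset_card_le _).trans_lt ?_
      have h1 := hd x
      have h2 := hd y
      simp only [hcons, Sym2.mem_iff, true_or, or_true, if_true] at h1 h2
      simp only [degIn, List.countP_eq_length_filter] at h1 h2
      simp only [F, List.length_map, List.length_append]
      omega
    obtain ⟨a, ha, haF⟩ : ∃ a ∈ Finset.range (2 * d), a ∉ (F.map c).toFinset :=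
      Finset.exists_mem_notMem_of_card_lt_card (by rwa [Finset.card_range])
    have hnew : ∀ f ∈ l, (∃ v, v ∈ s(x, y) ∧ v ∈ f) → c f ≠ a := by
      rintro f hf ⟨v, hv, hvf⟩ rfl
      apply haF
      simp only [List.mem_toFinset, List.mem_map]
      refine ⟨f, ?_, rfl⟩
      simp only [F, List.mem_append, List.mem_filter, hf, true_and, decide_eq_true_eq]
      rcases Sym2.mem_iff.1 hv with rfl | rfl
      · exact Or.inl hvf
      · exact Or.inr hvf
    have hne : ∀ f ∈ l, f ≠ s(x, y) := fun f hf h => he (h ▸ hf)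
    refine ⟨Function.update c s(x, y) a, ?_, ?_⟩
    · intro f hf f' hf' hff ⟨v, hv, hv'⟩
      rcases List.mem_cons.1 hf with rfl | hf
      · rcases List.mem_cons.1 hf' with rfl | hf'
        · exact absurd rfl hff
        · rw [Function.update_self, Function.update_of_ne (hne _ hf')]
          exact (hnew _ hf' ⟨v, hv, hv'⟩).symm
      · rcases List.mem_cons.1 hf' with rfl | hf'
        · rw [Function.update_self, Function.update_of_ne (hne _ hf)]
          exact hnew _ hf ⟨v, hv', hv⟩
        · rw [Function.update_of_ne (hne _ hf), Function.update_of_ne (hne _ hf')]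
          exact hc f hf f' hf' hff ⟨v, hv, hv'⟩
    · intro f hf
      rcases List.mem_cons.1 hf with rfl | hf
      · rw [Function.update_self]; exact Finset.mem_range.1 ha
      · rw [Function.update_of_ne (hne _ hf)]; exact hlt f hf

/-- A proper coloring of a list of edges with fewer than twice as many colors as the maximum
degree. -/
def greedyColor (l : List (Sym2 (Fin n))) : Sym2 (Fin n) → ℕ := (exists_isProperOn l).choose

theorem isProperOn_greedyColor (l : List (Sym2 (Fin n))) : IsProperOn l (greedyColor l) :=
  (exists_isProperOn l).choose_spec.1

theorem greedyColor_lt {l : List (Sym2 (Fin n))} {f : Sym2 (Fin n)} (hf : f ∈ l) {d : ℕ}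
    (hd : ∀ v, degIn l v ≤ d) : greedyColor l f < 2 * d :=
  ((exists_isProperOn l).choose_spec.2 f hf).trans_le
    (Nat.mul_le_mul_left 2 (Finset.sup_le fun v _ => hd v))

/-! ### The machine -/

/-- An injective numbering of the colors. -/
def colorCode : Color → ℕ := (Countable.exists_injective_nat Color).choose

theorem colorCode_injective : Function.Injective colorCode :=
  (Countable.exists_injective_nat Color).choose_spec

/-- A random seed: two hash functions from vertices to numbers below `n * n`, for each of `R`
rounds. -/
abbrev Seed (n R : ℕ) := Fin R → Fin n → Fin (n * n) × Fin (n * n)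

/-- The number of bits by which palettes are larger than needed, at a given scale. A larger `q`
makes the palettes smaller, at the price of more rounds. -/
def slack (q i : ℕ) : ℕ := i / q + 1

/-- An edge is good in some round. -/
def Colorable (q : ℕ) {R : ℕ} (ω : Seed n R) (b : Batch (Fin n)) (f : Sym2 (Fin n)) : Prop :=
  ∃ ρ : Fin R, b.Good (slack q b.scale) ρ (hashValue (ω ρ)) f

open scoped Classical in
/-- The color of an edge in a round in which it is good. -/
def batchColor (q : ℕ) {R : ℕ} (ω : Seed n R) (b : Batch (Fin n)) (f : Sym2 (Fin n)) : Color :=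
  if h : Colorable q ω b f then
    .inl (b.color (slack q b.scale) h.choose (hashValue (ω h.choose)) f)
  else .inr 0

open scoped Classical in
/-- What is printed when a batch is complete. -/
def batchOutput (q : ℕ) {R : ℕ} (ω : Seed n R) (b : Batch (Fin n)) :
    List (Sym2 (Fin n) × ℕ) :=
  (b.edges.filter fun f => Colorable q ω b f).map fun f => (f, colorCode (batchColor q ω b f))

open scoped Classical in
/-- The edges that are kept in memory when a batch is complete. -/
def batchRest (q : ℕ) {R : ℕ} (ω : Seed n R) (b : Batch (Fin n)) : List (Sym2 (Fin n)) :=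
  b.edges.filter fun f => ¬ Colorable q ω b f

/-- The state of the algorithm. -/
@[ext] structure State (n R : ℕ) where
  /-- The random seed. -/
  seed : Seed n R
  /-- The current degrees. They determine the number of edges read so far. -/
  deg : Fin n → Fin n
  /-- The degrees at the start of the epoch of the last complete batch. -/
  base : Fin n → Fin n
  /-- The edges without a color: those of the current batch, the last one first, and then the
  leftover edges of earlier batches. -/
  pending : List (Sym2 (Fin n))

/-- Store numbers in words. -/
def toWords (d : Fin n → ℕ) (v : Fin n) : Fin n := ⟨d v % n, Nat.mod_lt _ v.pos⟩

theorem toWords_val {d : Fin n → ℕ} {v : Fin n} (h : d v < n) : (toWords d v : ℕ) = d v :=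
  Nat.mod_eq_of_lt h

/-- The algorithm: it collects the edges of a batch, and colors them when the batch is complete. -/
def machine (n q R : ℕ) : SeededMachine n (State n R) where
  step s e :=
    let post : Fin n → ℕ := fun v => s.deg v + if v ∈ e then 1 else 0
    let m := (∑ v, post v) / 2
    if m % n = 0 then
      let b := mkBatch (m / n - 1) ((e :: s.pending).take n).reverse post fun v => s.base v
      (⟨s.seed, toWords post, toWords b.base, batchRest q s.seed b ++ (e :: s.pending).drop n⟩,
        batchOutput q s.seed b)
    else (⟨s.seed, toWords post, s.base, e :: s.pending⟩, [])
  finish s := s.pending.map fun f => (f, colorCode (.inr (greedyColor s.pending f)))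

variable {q R : ℕ}

/-- The edges of the first `τ` batches that remain without a color. -/
def leftover (q : ℕ) (ω : Seed n R) (es : List (Sym2 (Fin n))) : ℕ → List (Sym2 (Fin n))
  | 0 => []
  | τ + 1 => batchRest q ω (batchAt es τ) ++ leftover q ω es τ

/-- The edges of the incomplete batch after `k` edges. -/
def buffer (es : List (Sym2 (Fin n))) (k : ℕ) : List (Sym2 (Fin n)) :=
  (es.take k).drop (k / n * n)

/-- The state after `k` edges. -/
def stateAt (q : ℕ) (ω : Seed n R) (es : List (Sym2 (Fin n))) (k : ℕ) : State n R where
  seed := ω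
  deg := toWords (degIn (es.take k))
  base := toWords (prevBase es (k / n))
  pending := (buffer es k).reverse ++ leftover q ω es (k / n)

/-- What is printed while reading the first `k` edges. -/
def printed (q : ℕ) (ω : Seed n R) (es : List (Sym2 (Fin n))) (k : ℕ) :
    List (Sym2 (Fin n) × ℕ) :=
  (List.range (k / n)).flatMap fun τ => batchOutput q ω (batchAt es τ)

theorem prevBase_lt {es : List (Sym2 (Fin n))} (h : IsSimpleStream es) (τ : ℕ) (v : Fin n) :
    prevBase es τ v < n := by
  cases τ with
  | zero => exact v.pos
  | succ τ =>
    calc (batchAt es τ).base v ≤ (batchAt es τ).pre v := batchAt_base_le v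
      _ = degIn (es.take (τ * n)) v := by rw [batchAt_pre]
      _ ≤ degIn es v := degIn_take_le es _ v
      _ < n := h.degIn_lt v

theorem length_buffer {es : List (Sym2 (Fin n))} {k : ℕ} (hk : k ≤ es.length) :
    (buffer es k).length = k % n := by
  have := Nat.div_add_mod k n
  rw [mul_comm] at this
  simp only [buffer, List.length_drop, List.length_take, min_eq_left hk]
  omega

theorem step_stateAt {es : List (Sym2 (Fin n))} (h : IsSimpleStream es) (ω : Seed n R) {k : ℕ}
    (hk : k < es.length) :
    ((machine n q R).step (stateAt q ω es k) es[k]).1 = stateAt q ω es (k + 1) ∧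
      printed q ω es k ++ ((machine n q R).step (stateAt q ω es k) es[k]).2 =
        printed q ω es (k + 1) := by
  have hn : 0 < n := by
    have := es[k]
    induction this with | _ x y => exact x.pos
  have htake : es.take (k + 1) = es.take k ++ [es[k]] := by simp
  have hpost : (fun v => ((toWords (degIn (es.take k)) v : Fin n) : ℕ) +
      if v ∈ es[k] then 1 else 0) = degIn (es.take (k + 1)) := by
    funext v
    rw [toWords_val ((degIn_take_le es k v).trans_lt (h.degIn_lt v)), htake, degIn_append]
    simp [degIn]
  have hm : (∑ v, degIn (es.take (k + 1)) v) / 2 = k + 1 := by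
    rw [sum_degIn fun f hf => h.not_isDiag f (List.mem_of_mem_take hf), List.length_take,
      min_eq_left (by omega : k + 1 ≤ es.length)]
    omega
  have hbase : (fun v => ((toWords (prevBase es (k / n)) v : Fin n) : ℕ)) =
      prevBase es (k / n) := by
    funext v
    rw [toWords_val (prevBase_lt h _ v)]
  have hdm := Nat.div_add_mod k n
  rw [mul_comm] at hdm
  have hlt := Nat.mod_lt k hn
  have hbuf : (es.take (k + 1)).drop (k / n * n) = buffer es k ++ [es[k]] := by
    rw [htake, List.drop_append_of_le_length]
    · rfl
    · rw [List.length_take]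
      omega
  have hpend : es[k] :: (stateAt q ω es k).pending =
      (buffer es k ++ [es[k]]).reverse ++ leftover q ω es (k / n) := by
    simp [stateAt]
  simp only [machine, hpend]
  simp only [stateAt, hpost, hm, hbase]
  by_cases hc : (k + 1) % n = 0
  · -- The batch is complete.
    have hkn : k % n + 1 = n := by
      rcases Nat.lt_or_ge (k % n + 1) n with h1 | h1
      · rw [Nat.add_mod, Nat.mod_eq_of_lt (by omega : 1 < n), Nat.mod_eq_of_lt h1] at hc
        omega
      · omega
    have hk1 : (k / n + 1) * n = k + 1 := by rw [add_mul, one_mul]; omega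
    have hdiv : (k + 1) / n = k / n + 1 := by rw [← hk1, Nat.mul_div_cancel _ hn]
    have hedges : buffer es k ++ [es[k]] = batchEdges es (k / n) := by
      rw [← hbuf, batchEdges, List.take_drop, ← hk1, add_mul, one_mul]
    have hlen : ((buffer es k ++ [es[k]]).reverse).length = n := by
      rw [List.length_reverse, List.length_append, length_buffer hk.le]
      simpa using hkn
    rw [if_pos hc, List.take_left' hlen, List.drop_left' hlen, List.reverse_reverse, hedges, hdiv,
      Nat.add_sub_cancel]
    have hb : mkBatch (k / n) (batchEdges es (k / n)) (degIn (es.take (k + 1)))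
        (prevBase es (k / n)) = batchAt es (k / n) := by
      rw [batchAt, hk1]
    rw [hb]
    refine ⟨?_, ?_⟩
    · have : buffer es (k + 1) = [] := by
        rw [buffer, hdiv, hk1]
        simp
      rw [this]
      rfl
    · simp only [printed, hdiv]
      rw [List.range_succ, List.flatMap_append]
      simp
  · have hkn : k % n + 1 < n := by
      by_contra h1
      apply hc
      have : k + 1 = (k / n + 1) * n := by rw [add_mul, one_mul]; omega
      rw [this, Nat.mul_mod_left]
    have hdiv : (k + 1) / n = k / n := by
      rw [Nat.div_eq_iff hn]
      omega
    rw [if_neg hc]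
    refine ⟨?_, ?_⟩
    · simp only [hdiv]
      rw [← hbuf]
      simp [buffer, hdiv]
    · simp [printed, hdiv]

/-- The output of the machine, and a bound for its space. -/
theorem exec_stateAt {es : List (Sym2 (Fin n))} (h : IsSimpleStream es) (ω : Seed n R)
    (size : State n R → ℕ) {B : ℕ} (hB : ∀ k ≤ es.length, size (stateAt q ω es k) ≤ B) {k : ℕ}
    (hk : k ≤ es.length) :
    ((machine n q R).exec size (es.drop k) (stateAt q ω es k)).1 ≤ B ∧
      printed q ω es k ++ ((machine n q R).exec size (es.drop k) (stateAt q ω es k)).2 =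
        printed q ω es es.length ++ (machine n q R).finish (stateAt q ω es es.length) := by
  induction hd : es.length - k generalizing k with
  | zero =>
    obtain rfl : k = es.length := by omega
    rw [List.drop_length]
    exact ⟨hB _ le_rfl, rfl⟩
  | succ d ih =>
    have hk' : k < es.length := by omega
    obtain ⟨h1, h2⟩ := step_stateAt (q := q) h ω hk'
    obtain ⟨h3, h4⟩ := ih (k := k + 1) hk' (by omega)
    rw [List.drop_eq_getElem_cons hk', SeededMachine.exec]
    simp only [h1]
    refine ⟨max_le (hB k hk) h3, ?_⟩
    rw [← List.append_assoc, h2, h4]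

/-! ### Memory -/

/-- The words that store what concerns one vertex. -/
def vertexWords (s : State n R) (v : Fin n) : List (Fin n) :=
  s.deg v :: s.base v :: (List.finRange R).flatMap fun ρ =>
    [(finProdFinEquiv.symm (s.seed ρ v).1).1, (finProdFinEquiv.symm (s.seed ρ v).1).2,
      (finProdFinEquiv.symm (s.seed ρ v).2).1, (finProdFinEquiv.symm (s.seed ρ v).2).2]

/-- The two endpoints of an edge. -/
def edgeWords (f : Sym2 (Fin n)) : List (Fin n) := [f.out.1, f.out.2]

/-- The memory contents that represent a state. -/
def encode (s : State n R) : List (Fin n) :=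
  ((List.finRange n).flatMap fun v => vertexWords s v) ++ s.pending.flatMap edgeWords

theorem length_flatMap_const {α β : Type} (l : List α) (f : α → List β) {c : ℕ}
    (hf : ∀ a ∈ l, (f a).length = c) : (l.flatMap f).length = l.length * c := by
  induction l with
  | nil => simp
  | cons a l ih =>
    rw [List.flatMap_cons, List.length_append, ih fun b hb => hf b (List.mem_cons_of_mem _ hb),
      hf a List.mem_cons_self, List.length_cons]
    ring

theorem eq_of_flatMap_eq {α β : Type} {l : List α} {f g : α → List β}
    (hlen : ∀ a, (f a).length = (g a).length) (h : l.flatMap f = l.flatMap g) :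
    ∀ a ∈ l, f a = g a := by
  induction l with
  | nil => simp
  | cons a l ih =>
    rw [List.flatMap_cons, List.flatMap_cons] at h
    obtain ⟨h1, h2⟩ := List.append_inj h (hlen a)
    intro b hb
    rcases List.mem_cons.1 hb with rfl | hb
    · exact h1
    · exact ih h2 b hb

theorem edgeWords_injective : Function.Injective (edgeWords (n := n)) := by
  intro f f' h
  simp only [edgeWords, List.cons.injEq, and_true] at h
  have : f.out = f'.out := Prod.ext h.1 h.2
  rw [← Quot.out_eq f, ← Quot.out_eq f', this]

theorem flatMap_edgeWords_injective {l l' : List (Sym2 (Fin n))}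
    (h : l.flatMap edgeWords = l'.flatMap edgeWords) : l = l' := by
  induction l generalizing l' with
  | nil =>
    cases l' with
    | nil => rfl
    | cons a l' => simp [edgeWords] at h
  | cons a l ih =>
    cases l' with
    | nil => simp [edgeWords] at h
    | cons b l' =>
      rw [List.flatMap_cons, List.flatMap_cons] at h
      obtain ⟨h1, h2⟩ := List.append_inj h (by simp [edgeWords])
      rw [edgeWords_injective h1, ih h2]

theorem length_vertexWords (s : State n R) (v : Fin n) :
    (vertexWords s v).length = 4 * R + 2 := by
  rw [vertexWords, List.length_cons, List.length_cons,
    length_flatMap_const (c := 4) _ _ (by simp), List.length_finRange]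
  ring

theorem length_encode (s : State n R) :
    (encode s).length = n * (4 * R + 2) + 2 * s.pending.length := by
  rw [encode, List.length_append,
    length_flatMap_const _ _ fun v _ => length_vertexWords s v,
    length_flatMap_const (c := 2) _ _ (by simp [edgeWords]), List.length_finRange]
  ring

theorem encode_injective : Function.Injective (encode (n := n) (R := R)) := by
  intro s s' h
  obtain ⟨h1, h2⟩ := List.append_inj h (by
    rw [length_flatMap_const _ _ fun v _ => length_vertexWords s v,
      length_flatMap_const _ _ fun v _ => length_vertexWords s' v])
  have h3 : ∀ v, vertexWords s v = vertexWords s' v := fun v =>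
    eq_of_flatMap_eq (fun v => by rw [length_vertexWords, length_vertexWords]) h1 v
      (List.mem_finRange v)
  simp only [vertexWords, List.cons.injEq] at h3
  refine State.ext ?_ (funext fun v => (h3 v).1) (funext fun v => (h3 v).2.1)
    (flatMap_edgeWords_injective h2)
  funext ρ v
  have h4 := eq_of_flatMap_eq (by simp) (h3 v).2.2 ρ (List.mem_finRange ρ)
  simp only [List.cons.injEq, and_true] at h4
  exact Prod.ext (finProdFinEquiv.symm.injective (Prod.ext h4.1 h4.2.1))
    (finProdFinEquiv.symm.injective (Prod.ext h4.2.2.1 h4.2.2.2))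

theorem leftover_length_mono (ω : Seed n R) (es : List (Sym2 (Fin n))) {τ τ' : ℕ} (h : τ ≤ τ') :
    (leftover q ω es τ).length ≤ (leftover q ω es τ').length := by
  induction τ', h using Nat.le_induction with
  | base => rfl
  | succ τ' _ ih => rw [leftover, List.length_append]; omega

/-- The space used by the algorithm for a given seed. -/
theorem length_encode_stateAt_le (ω : Seed n R) (es : List (Sym2 (Fin n))) {k : ℕ}
    (hk : k ≤ es.length) : (encode (stateAt q ω es k)).length ≤
      n * (4 * R + 4) + 2 * (leftover q ω es (es.length / n)).length := by
  rw [length_encode, stateAt, List.length_append, List.length_reverse, length_buffer hk]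
  have h1 := leftover_length_mono (q := q) ω es (Nat.div_le_div_right (c := n) hk)
  have h2 : k % n ≤ n := by
    rcases Nat.eq_zero_or_pos n with rfl | hn
    · have : es = [] := by
        rcases es with _ | ⟨e, -⟩
        · rfl
        · induction e with | _ x y => exact x.elim0
      simp [this] at hk
      simp [hk]
    · exact (Nat.mod_lt k hn).le
  have h3 : n * (4 * R + 4) = n * (4 * R + 2) + 2 * n := by ring
  omega

/-! ### The output is a proper edge coloring -/

/-- The output of the algorithm on a stream, for a given seed. -/
def output (q : ℕ) (ω : Seed n R) (es : List (Sym2 (Fin n))) : List (Sym2 (Fin n) × ℕ) :=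
  printed q ω es es.length ++ (machine n q R).finish (stateAt q ω es es.length)

theorem perm_printed (ω : Seed n R) (es : List (Sym2 (Fin n))) (τ : ℕ) :
    (((List.range τ).flatMap fun τ => batchOutput q ω (batchAt es τ)).map Prod.fst ++
      leftover q ω es τ).Perm (es.take (τ * n)) := by
  classical
  induction τ with
  | zero => simp [leftover]
  | succ τ ih =>
    have h1 : ((batchOutput q ω (batchAt es τ)).map Prod.fst ++ batchRest q ω (batchAt es τ)).Perm
        (batchEdges es τ) := by
      have : (batchOutput q ω (batchAt es τ)).map Prod.fst =
          (batchEdges es τ).filter fun f => Colorable q ω (batchAt es τ) f := by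
        simp [batchOutput, Function.comp_def]
      rw [this, batchRest]
      simpa using List.filter_append_perm (fun f => decide (Colorable q ω (batchAt es τ) f))
        (batchEdges es τ)
    rw [List.range_succ, List.flatMap_append, List.map_append, leftover, add_mul, one_mul,
      List.take_add]
    refine List.Perm.trans ?_ (ih.append h1)
    simp only [List.flatMap_cons, List.flatMap_nil, List.append_nil, List.append_assoc]
    refine List.Perm.append_left _ ?_
    rw [← List.append_assoc]
    exact List.perm_append_comm

theorem perm_output (ω : Seed n R) (es : List (Sym2 (Fin n))) :
    ((output q ω es).map Prod.fst).Perm es := by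
  have h1 := perm_printed (q := q) ω es (es.length / n)
  have h2 : ((machine n q R).finish (stateAt q ω es es.length)).map Prod.fst =
      (buffer es es.length).reverse ++ leftover q ω es (es.length / n) := by
    simp [machine, stateAt, Function.comp_def]
  have h3 : es.take (es.length / n * n) ++ buffer es es.length = es := by
    rw [buffer, List.take_length, List.take_append_drop]
  rw [output, List.map_append, h2, printed]
  conv_rhs => rw [← h3]
  refine List.Perm.trans ?_ (h1.append_right _)
  rw [List.append_assoc]
  exact List.Perm.append_left _ (List.perm_append_comm.trans
    (List.Perm.append_left _ (List.reverse_perm _)))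

/-- Every item of the output is either an edge that is good in some round, or an edge colored
greedily at the end. -/
theorem mem_output {ω : Seed n R} {es : List (Sym2 (Fin n))} {p : Sym2 (Fin n) × ℕ}
    (hp : p ∈ output q ω es) :
    (∃ τ < es.length / n, p.1 ∈ (batchAt es τ).edges ∧ ∃ ρ : Fin R,
      (batchAt es τ).Good (slack q (batchAt es τ).scale) ρ (hashValue (ω ρ)) p.1 ∧
      p.2 = colorCode (.inl ((batchAt es τ).color (slack q (batchAt es τ).scale) ρ
        (hashValue (ω ρ)) p.1))) ∨
    (p.1 ∈ (stateAt q ω es es.length).pending ∧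
      p.2 = colorCode (.inr (greedyColor (stateAt q ω es es.length).pending p.1))) := by
  rcases List.mem_append.1 hp with h | h
  · left
    simp only [printed, List.mem_flatMap, List.mem_range, batchOutput, List.mem_map,
      List.mem_filter, decide_eq_true_eq] at h
    obtain ⟨τ, hτ, f, ⟨hf, hc⟩, rfl⟩ := h
    refine ⟨τ, hτ, hf, hc.choose, hc.choose_spec, ?_⟩
    simp only [batchColor, dif_pos hc]
  · right
    simp only [machine, List.mem_map] at h
    obtain ⟨f, hf, rfl⟩ := h
    exact ⟨hf, rfl⟩

theorem output_proper {es : List (Sym2 (Fin n))} (h : IsSimpleStream es) (ω : Seed n R)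
    {p p' : Sym2 (Fin n) × ℕ} (hp : p ∈ output q ω es) (hp' : p' ∈ output q ω es)
    (hne : p.1 ≠ p'.1) (hw : ∃ v, v ∈ p.1 ∧ v ∈ p'.1) : p.2 ≠ p'.2 := by
  have hw' : ∃ v, v ∈ p'.1 ∧ v ∈ p.1 := hw.imp fun v hv => hv.symm
  rcases mem_output hp with ⟨τ, hτ, hf, ρ, hg, hc⟩ | ⟨hf, hc⟩ <;>
  rcases mem_output hp' with ⟨τ', hτ', hf', ρ', hg', hc'⟩ | ⟨hf', hc'⟩ <;>
  rw [hc, hc'] <;> refine fun he => ?_ <;> have he := colorCode_injective he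
  · have he := Sum.inl_injective he
    -- Extend the hash functions beyond the last round, to index them by numbers.
    set H : ℕ → Fin n → ℕ × ℕ := fun ρ =>
      if hρ : ρ < R then hashValue (ω ⟨ρ, hρ⟩) else fun _ => (0, 0) with hH
    have hHρ : ∀ ρ : Fin R, hashValue (ω ρ) = H ρ := fun ρ => by simp [hH]
    have hscale : (batchAt es τ).scale = (batchAt es τ').scale :=
      congrArg (fun c => c.1.2.1) he
    have hround : ρ = ρ' := Fin.ext (congrArg (fun c => c.1.1) he)
    rw [hHρ] at hg he
    rw [hHρ] at hg'
    rw [hHρ ρ'] at he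
    rcases lt_trichotomy τ τ' with hlt | rfl | hlt
    · rw [← hscale] at he
      exact Batch.color_ne_of_before (h.wellFormed hτ) (h.wellFormed hτ')
        (batchAt_before hlt) hf hf' hw hg he
    · subst hround
      exact hg.2 _ hf' hne.symm hw he.symm
    · rw [hscale] at he
      exact Batch.color_ne_of_before (h.wellFormed hτ') (h.wellFormed hτ)
        (batchAt_before hlt) hf' hf hw' hg' he.symm
  · cases he
  · cases he
  · exact isProperOn_greedyColor _ _ hf _ hf' hne hw (Sum.inr_injective he)

/-! ### The expected number of leftover edges -/

theorem sum_length_filter_le {Ω α : Type} [Fintype Ω] (P : Ω → α → Prop)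
    [∀ ω, DecidablePred (P ω)] [∀ a, DecidablePred fun ω => P ω a] (l : List α) {B : ℝ}
    (h : ∀ a ∈ l, ((Finset.univ.filter fun ω => P ω a).card : ℝ) ≤ B) :
    ∑ ω, ((l.filter fun a => P ω a).length : ℝ) ≤ l.length * B := by
  induction l with
  | nil => simp
  | cons a l ih =>
    have h1 : ∀ ω, (((a :: l).filter fun a => P ω a).length : ℝ) =
        (if P ω a then 1 else 0) + ((l.filter fun a => P ω a).length : ℝ) := fun ω => by
      rw [List.filter_cons]
      by_cases hP : P ω a <;> simp [hP, add_comm]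
    simp only [h1, Finset.sum_add_distrib, List.length_cons, Nat.cast_add, Nat.cast_one, add_mul,
      one_mul]
    have h2 := ih fun b hb => h b (List.mem_cons_of_mem _ hb)
    have h3 := h a List.mem_cons_self
    rw [Finset.card_filter] at h3
    push_cast at h3
    linarith

theorem sum_one_div_sq_le (T : ℕ) : ∑ τ ∈ Finset.range T, (1 : ℝ) / ((τ : ℝ) + 1) ^ 2 ≤ 2 := by
  suffices h : ∑ τ ∈ Finset.range T, (1 : ℝ) / ((τ : ℝ) + 1) ^ 2 ≤ 2 - 1 / (T : ℝ) by
    have : (0 : ℝ) ≤ 1 / (T : ℝ) := by positivity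
    linarith
  induction T with
  | zero => norm_num
  | succ T ih =>
    rw [Finset.sum_range_succ]
    rcases Nat.eq_zero_or_pos T with rfl | hT
    · norm_num
    · have hT' : (0 : ℝ) < T := by exact_mod_cast hT
      have h1 : (1 : ℝ) / ((T : ℝ) + 1) ^ 2 ≤ 1 / T - 1 / (T + 1) := by
        rw [div_sub_div _ _ hT'.ne' (by positivity), div_le_div_iff₀ (by positivity)
          (by positivity)]
        nlinarith
      push_cast
      linarith

/-- The edges that are good in no round are so few that their expected number is linear in `n`. -/
theorem sum_length_batchRest_le {es : List (Sym2 (Fin n))} (h : IsSimpleStream es) (hq : 0 < q)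
    {τ : ℕ} (hτ : τ < es.length / n) :
    ∑ ω : Seed n (6 * q), ((batchRest q ω (batchAt es τ)).length : ℝ) ≤
      n * ((2 ^ 17) ^ (6 * q) * (1 / ((τ : ℝ) + 1) ^ 2) * Fintype.card (Seed n (6 * q))) := by
  classical
  have hn : 0 < n := Nat.pos_of_ne_zero fun h0 => by simp [h0] at hτ
  set i := (batchAt es τ).scale with hi
  have hs : 64 ^ i ≤ 64 * (n * n) := by
    have h1 : 8 ^ i ≤ 8 ^ Nat.clog 8 n :=
      Nat.pow_le_pow_right (by norm_num) (batchAt_scale_le fun v => (h.degIn_lt v).le)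
    have h2 := h1.trans (eight_pow_clog_le hn)
    calc 64 ^ i = 8 ^ i * 8 ^ i := by rw [← mul_pow]; norm_num
      _ ≤ (8 * n) * (8 * n) := Nat.mul_le_mul h2 h2
      _ = _ := by ring
  have ht : slack q i ≤ i + 1 := Nat.succ_le_succ (Nat.div_le_self _ _)
  -- The number of rounds makes the failure probability smaller than `1 / (τ + 1) ^ 2`.
  have hpow : ((τ : ℝ) + 1) ^ 2 ≤ (2 ^ slack q i) ^ (6 * q) := by
    have h1 : 2 * (τ + 1) ≤ 8 ^ i := h.two_mul_le_pow_scale hτ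
    have h2 : i ≤ slack q i * q := by
      have h3 := Nat.div_add_mod i q
      have h4 := Nat.mod_lt i hq
      rw [slack, add_mul, one_mul, mul_comm]
      omega
    have h5 : (τ + 1) ^ 2 ≤ (2 ^ slack q i) ^ (6 * q) := by
      calc (τ + 1) ^ 2 ≤ (8 ^ i) ^ 2 := Nat.pow_le_pow_left (by omega) 2
        _ = 2 ^ (6 * i) := by
          rw [show 6 * i = 3 * i * 2 by ring, pow_mul, pow_mul]; norm_num
        _ ≤ 2 ^ (slack q i * (6 * q)) := Nat.pow_le_pow_right (by norm_num) (by linarith)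
        _ = _ := by rw [pow_mul]
    exact_mod_cast h5
  have key := sum_length_filter_le
    (fun (ω : Seed n (6 * q)) f => ¬ Colorable q ω (batchAt es τ) f) (batchAt es τ).edges
    (B := (2 ^ 17) ^ (6 * q) * (1 / ((τ : ℝ) + 1) ^ 2) * Fintype.card (Seed n (6 * q))) ?_
  · refine le_trans (le_of_eq ?_) (key.trans ?_)
    · simp only [batchRest]
    · gcongr
      rw [batchAt_edges, batchEdges]
      exact List.length_take_le _ _
  · intro f hf
    have h1 := (h.wellFormed hτ).card_forall_not_good_le (6 * q) (Nat.mul_pos hn hn) hs ht hf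
    have h2 : (2 ^ 17 / 2 ^ slack q i : ℝ) ^ (6 * q) ≤
        (2 ^ 17) ^ (6 * q) * (1 / ((τ : ℝ) + 1) ^ 2) := by
      rw [div_pow, div_eq_mul_one_div]
      gcongr
    simp only [Colorable, not_exists]
    refine le_trans (le_of_eq ?_) (h1.trans (mul_le_mul_of_nonneg_right h2 (by positivity)))
    congr!

theorem sum_length_leftover_le {es : List (Sym2 (Fin n))} (h : IsSimpleStream es) (hq : 0 < q) :
    ∑ ω : Seed n (6 * q), ((leftover q ω es (es.length / n)).length : ℝ) ≤
      2 * (2 ^ 17) ^ (6 * q) * n * Fintype.card (Seed n (6 * q)) := by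
  have key : ∀ T ≤ es.length / n,
      ∑ ω : Seed n (6 * q), ((leftover q ω es T).length : ℝ) ≤
        ∑ τ ∈ Finset.range T,
          n * ((2 ^ 17) ^ (6 * q) * (1 / ((τ : ℝ) + 1) ^ 2) * Fintype.card (Seed n (6 * q))) := by
    intro T hT
    induction T with
    | zero => simp [leftover]
    | succ T ih =>
      simp only [leftover, List.length_append, Nat.cast_add, Finset.sum_add_distrib,
        Finset.sum_range_succ]
      rw [add_comm]
      exact add_le_add (ih (by omega)) (sum_length_batchRest_le h hq hT)
  refine (key _ le_rfl).trans ?_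
  have h2 := sum_one_div_sq_le (es.length / n)
  have h3 : ∀ τ : ℕ,
      n * ((2 ^ 17) ^ (6 * q) * (1 / ((τ : ℝ) + 1) ^ 2) * Fintype.card (Seed n (6 * q))) =
      (1 / ((τ : ℝ) + 1) ^ 2) * ((2 ^ 17) ^ (6 * q) * n * Fintype.card (Seed n (6 * q))) :=
    fun τ => by ring
  simp only [h3]
  rw [← Finset.sum_mul]
  refine (mul_le_mul_of_nonneg_right h2 (by positivity)).trans_eq (by ring)

/-! ### The number of colors -/

open scoped Classical in
/-- The colors with given round, scale, levels and scheme. -/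
def paletteBlock (t ρ i hi lo : ℕ) (S : Scheme) :
    Finset ((ℕ × ℕ × ℕ × ℕ × Scheme × ℕ) × Sym2 (ℕ × ℕ × ℕ) × ℕ) :=
  (Finset.range (2 ^ S.timeExp i) ×ˢ (Finset.range (2 ^ t) ×ˢ
    Finset.range (2 ^ S.clockExp i hi hi)) ×ˢ (Finset.range (2 ^ t) ×ˢ
    Finset.range (2 ^ S.clockExp i hi lo)) ×ˢ Finset.range (2 ^ (S.hashExp i hi lo + t))).image
  fun p => ((ρ, i, hi, lo, S, p.1),
    s((p.2.1.1, hi, p.2.1.2), (p.2.2.1.1, lo, p.2.2.1.2)), p.2.2.2)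

theorem card_paletteBlock_le {t ρ i hi lo : ℕ} {S : Scheme} (hlo : lo ≤ hi) (hhi : hi ≤ 3 * i)
    (h : S.Admissible i hi lo) : (paletteBlock t ρ i hi lo S).card ≤ 2 ^ (4 * i + 3 * t) := by
  classical
  refine Finset.card_image_le.trans ?_
  simp only [Finset.card_product, Finset.card_range, ← pow_add]
  exact Nat.pow_le_pow_right (by norm_num) (by have := S.exponent_sum_le hlo hhi h; omega)

open scoped Classical in
/-- All colors that occur up to the scale `I`. -/
def palette (q R I : ℕ) : Finset ((ℕ × ℕ × ℕ × ℕ × Scheme × ℕ) × Sym2 (ℕ × ℕ × ℕ) × ℕ) :=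
  ((Finset.range R ×ˢ Finset.range (I + 1) ×ˢ Finset.range (3 * I + 1) ×ˢ
    Finset.range (3 * I + 1) ×ˢ (Finset.univ : Finset Scheme)).filter fun a =>
      a.2.2.2.1 ≤ a.2.2.1 ∧ a.2.2.1 ≤ 3 * a.2.1 ∧
        a.2.2.2.2.Admissible a.2.1 a.2.2.1 a.2.2.2.1).biUnion
  fun a => paletteBlock (slack q a.2.1) a.1 a.2.1 a.2.2.1 a.2.2.2.1 a.2.2.2.2

theorem card_palette_le (q R I : ℕ) : (palette q R I).card ≤
    R * ((I + 1) * ((3 * I + 1) * ((3 * I + 1) * 4))) * 2 ^ (4 * I + 3 * slack q I) := by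
  classical
  refine (Finset.card_biUnion_le_card_mul _ _ (2 ^ (4 * I + 3 * slack q I)) ?_).trans
    (Nat.mul_le_mul_right _ ((Finset.card_filter_le _ _).trans_eq ?_))
  · rintro ⟨ρ, i, hi, lo, S⟩ ha
    simp only [Finset.mem_filter, Finset.mem_product, Finset.mem_range] at ha
    dsimp only
    refine (card_paletteBlock_le ha.2.1 ha.2.2.1 ha.2.2.2).trans
      (Nat.pow_le_pow_right (by norm_num) ?_)
    have hi : i ≤ I := by omega
    have : slack q i ≤ slack q I := Nat.succ_le_succ (Nat.div_le_div_right hi)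
    omega
  · have : Fintype.card Scheme = 4 := rfl
    simp [this]

theorem Batch.WellFormed.color_mem_palette {b : Batch (Fin n)} (hb : b.WellFormed) {I ρ : ℕ}
    (hI : b.scale ≤ I) (hρ : ρ < R) (h : Fin n → ℕ × ℕ) (f : Sym2 (Fin n)) :
    b.color (slack q b.scale) ρ h f ∈ palette q R I := by
  classical
  have hhi := hb.hi_le f
  have hlo := b.lo_le_hi f
  have hhiI := hhi.trans (Nat.mul_le_mul_left 3 hI)
  simp only [palette, Finset.mem_biUnion, Finset.mem_filter, Finset.mem_product, Finset.mem_range,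
    Finset.mem_univ]
  refine ⟨(ρ, b.scale, b.hi f, b.lo f, b.scheme f), ⟨⟨hρ, Nat.lt_succ_of_le hI,
    Nat.lt_succ_of_le hhiI, Nat.lt_succ_of_le (hlo.trans hhiI), trivial⟩,
    hlo, hhi, b.admissible_scheme f⟩, ?_⟩
  -- Name the endpoint of higher level first.
  obtain ⟨x, y, rfl, hxy⟩ : ∃ x y, f = s(x, y) ∧ b.level y ≤ b.level x := by
    induction f with | _ x y
    rcases le_total (b.level y) (b.level x) with h1 | h1
    · exact ⟨x, y, rfl, h1⟩
    · exact ⟨y, x, Sym2.eq_swap, h1⟩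
  have hx : b.hi s(x, y) = b.level x := by simp [hxy]
  have hy : b.lo s(x, y) = b.level y := by simp [hxy]
  have hclock : ∀ v, b.clock h (b.scheme s(x, y)) (b.hi s(x, y)) v <
      2 ^ (b.scheme s(x, y)).clockExp b.scale (b.hi s(x, y)) (b.level v) :=
    fun v => Nat.mod_lt _ (by positivity)
  have hside : ∀ v, Batch.side (slack q b.scale) h v < 2 ^ slack q b.scale :=
    fun v => Nat.mod_lt _ (by positivity)
  refine Finset.mem_image.2 ⟨((b.scheme s(x, y)).time b.scale b.idx,
    (Batch.side (slack q b.scale) h x, b.clock h (b.scheme s(x, y)) (b.hi s(x, y)) x),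
    (Batch.side (slack q b.scale) h y, b.clock h (b.scheme s(x, y)) (b.hi s(x, y)) y),
    Batch.hash h ((b.scheme s(x, y)).hashExp b.scale (b.hi s(x, y)) (b.lo s(x, y)) +
      slack q b.scale) s(x, y)), ?_, ?_⟩
  · simp only [Finset.mem_product, Finset.mem_range]
    refine ⟨hb.time_lt _, ⟨hside x, ?_⟩, ⟨hside y, ?_⟩, Nat.mod_lt _ (by positivity)⟩
    · conv_rhs => rw [hx]
      have := hclock x
      rwa [hx] at this ⊢
    · rw [hy]
      exact hclock y
  · simp only [Batch.color, Sym2.map_mk, Batch.attr, hx, hy]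

/-- The number of different colors in the output. -/
theorem card_colors_output_le {es : List (Sym2 (Fin n))} (h : IsSimpleStream es) (ω : Seed n R)
    {D : ℕ} (hD : ∀ v, degIn es v ≤ D) :
    ((output q ω es).map Prod.snd).toFinset.card ≤
      (palette q R (Nat.clog 8 D)).card + 2 * D := by
  classical
  have hsub : ((output q ω es).map Prod.snd).toFinset ⊆
      ((palette q R (Nat.clog 8 D)).image fun c => colorCode (.inl c)) ∪
        (Finset.range (2 * D)).image fun c => colorCode (.inr c) := by
    intro c hc
    simp only [List.mem_toFinset, List.mem_map] at hc
    obtain ⟨p, hp, rfl⟩ := hc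
    rw [Finset.mem_union, Finset.mem_image, Finset.mem_image]
    rcases mem_output hp with ⟨τ, hτ, hf, ρ, -, hc⟩ | ⟨hf, hc⟩
    · exact Or.inl ⟨_, (h.wellFormed hτ).color_mem_palette (batchAt_scale_le hD) ρ.2 _ _, hc.symm⟩
    · refine Or.inr ⟨_, Finset.mem_range.2 (greedyColor_lt hf fun v => ?_), hc.symm⟩
      refine le_trans ?_ (hD v)
      have h1 : (stateAt q ω es es.length).pending.Subperm es := by
        refine List.Sublist.subperm ?_ |>.trans (perm_output (q := q) ω es).subperm
        have : ((machine n q R).finish (stateAt q ω es es.length)).map Prod.fst =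
            (stateAt q ω es es.length).pending := by simp [machine, Function.comp_def]
        rw [output, List.map_append, this]
        exact List.sublist_append_right _ _
      exact h1.countP_le _
  refine (Finset.card_le_card hsub).trans ((Finset.card_union_le _ _).trans
    (add_le_add Finset.card_image_le (Finset.card_image_le.trans_eq (Finset.card_range _))))

/-! ### The bounds in terms of the maximum degree -/

theorem natCast_add_one_pow_three_le {q : ℕ} (hq : 0 < q) (I : ℕ) :
    ((I : ℝ) + 1) ^ 3 ≤ 216 * q ^ 3 * ((2 : ℝ) ^ I) ^ ((1 : ℝ) / q) := by
  have hq' : (1 : ℝ) ≤ q := by exact_mod_cast hq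
  have hlog : (1 : ℝ) / 2 ≤ Real.log 2 := by linarith [Real.log_two_gt_d9]
  have h1 : (I : ℝ) + 1 ≤ 6 * q * Real.exp (I / (6 * q)) := by
    have h2 := Real.add_one_le_exp ((I : ℝ) / (6 * q))
    calc (I : ℝ) + 1 ≤ 6 * q * (I / (6 * q) + 1) := by
          rw [mul_add, mul_div_cancel₀ _ (by positivity)]
          linarith
      _ ≤ _ := by gcongr
  have h3 : Real.exp (I / (6 * q)) ^ 3 ≤ ((2 : ℝ) ^ I) ^ ((1 : ℝ) / q) := by
    rw [← Real.exp_nat_mul, ← Real.rpow_natCast 2 I, ← Real.rpow_mul (by norm_num),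
      Real.rpow_def_of_pos (by norm_num)]
    apply Real.exp_le_exp.2
    have : (0 : ℝ) ≤ I / q := by positivity
    calc ((3 : ℕ) : ℝ) * (I / (6 * q)) = 1 / 2 * (I / q) := by
          push_cast
          field_simp
          ring
      _ ≤ Real.log 2 * (I / q) := by gcongr
      _ = _ := by ring
  calc ((I : ℝ) + 1) ^ 3 ≤ (6 * q * Real.exp (I / (6 * q))) ^ 3 := by gcongr
    _ = 216 * q ^ 3 * Real.exp (I / (6 * q)) ^ 3 := by ring
    _ ≤ _ := by gcongr

/-- The palettes have size `O(D ^ (4 / 3 + ε))`. -/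
theorem card_palette_clog_le {q R D : ℕ} (hq : 0 < q) (hD : 0 < D) {ε : ℝ} (hε : 4 ≤ 3 * ε * q) :
    ((palette q R (Nat.clog 8 D)).card : ℝ) ≤
      36 * 216 * 8 * 256 * R * q ^ 3 * (D : ℝ) ^ ((4 : ℝ) / 3 + ε) := by
  set I := Nat.clog 8 D with hI
  have hq' : (1 : ℝ) ≤ q := by exact_mod_cast hq
  have hD' : (1 : ℝ) ≤ D := by exact_mod_cast hD
  have hxD : (2 : ℝ) ^ I ≤ 2 * (D : ℝ) ^ ((1 : ℝ) / 3) := by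
    have h1 : ((2 : ℝ) ^ I) ^ 3 ≤ (2 * (D : ℝ) ^ ((1 : ℝ) / 3)) ^ 3 := by
      have h2 : (8 : ℝ) ^ I ≤ 8 * D := by exact_mod_cast eight_pow_clog_le hD
      rw [mul_pow, ← Real.rpow_natCast ((D : ℝ) ^ ((1 : ℝ) / 3)), ← Real.rpow_mul (by positivity),
        ← pow_mul, mul_comm I 3, pow_mul]
      norm_num
      exact h2
    exact le_of_pow_le_pow_left₀ (by norm_num) (by positivity) h1
  have h1 : ((palette q R I).card : ℝ) ≤
      R * (36 * ((I : ℝ) + 1) ^ 3) * 2 ^ (4 * I + 3 * slack q I) := by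
    have h2 := (Nat.cast_le (α := ℝ)).2 (card_palette_le q R I)
    push_cast at h2
    refine h2.trans ?_
    have hI0 : (0 : ℝ) ≤ I := by positivity
    have h3 : ((I : ℝ) + 1) * ((3 * I + 1) * ((3 * I + 1) * 4)) ≤ 36 * ((I : ℝ) + 1) ^ 3 := by
      nlinarith [mul_nonneg hI0 hI0, mul_nonneg (mul_nonneg hI0 hI0) hI0]
    gcongr
  have h3 : (2 : ℝ) ^ (4 * I + 3 * slack q I) ≤ 8 * ((2 : ℝ) ^ I) ^ (4 + (3 : ℝ) / q) := by
    have h4 : (2 : ℝ) ^ (3 * (I / q)) ≤ ((2 : ℝ) ^ I) ^ ((3 : ℝ) / q) := by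
      rw [← Real.rpow_natCast 2 I, ← Real.rpow_mul (by norm_num), ← Real.rpow_natCast 2 (3 * _)]
      apply Real.rpow_le_rpow_of_exponent_le (by norm_num)
      push_cast
      calc 3 * ((I / q : ℕ) : ℝ) ≤ 3 * ((I : ℝ) / q) := by gcongr; exact Nat.cast_div_le
        _ = _ := by ring
    rw [Real.rpow_add (by positivity), show slack q I = I / q + 1 from rfl, mul_add, ← add_assoc,
      pow_add, pow_add, mul_comm 4 I, pow_mul]
    norm_num
    rw [mul_comm]
    gcongr
  have h5 := natCast_add_one_pow_three_le hq I
  have h6 : ((2 : ℝ) ^ I) ^ (4 + (4 : ℝ) / q) ≤ 256 * (D : ℝ) ^ ((4 : ℝ) / 3 + ε) := by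
    have h7 : (4 : ℝ) / q ≤ 4 := by rw [div_le_iff₀ (by positivity)]; linarith
    have h8 : (4 : ℝ) / (3 * q) ≤ ε := by
      rw [div_le_iff₀ (by positivity)]; linarith
    calc ((2 : ℝ) ^ I) ^ (4 + (4 : ℝ) / q)
        ≤ (2 * (D : ℝ) ^ ((1 : ℝ) / 3)) ^ (4 + (4 : ℝ) / q) := by gcongr
      _ = 2 ^ (4 + (4 : ℝ) / q) * (D : ℝ) ^ ((1 : ℝ) / 3 * (4 + (4 : ℝ) / q)) := by
          rw [Real.mul_rpow (by norm_num) (by positivity), ← Real.rpow_mul (by positivity)]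
      _ ≤ 2 ^ (8 : ℝ) * (D : ℝ) ^ ((4 : ℝ) / 3 + ε) := by
          have h9 : (1 : ℝ) / 3 * (4 + (4 : ℝ) / q) ≤ 4 / 3 + ε := by
            calc (1 : ℝ) / 3 * (4 + (4 : ℝ) / q) = 4 / 3 + 4 / (3 * q) := by field_simp
              _ ≤ _ := by linarith
          gcongr
          · norm_num
          · linarith
      _ = _ := by norm_num
  calc ((palette q R I).card : ℝ)
      ≤ R * (36 * ((I : ℝ) + 1) ^ 3) * 2 ^ (4 * I + 3 * slack q I) := h1
    _ ≤ R * (36 * (216 * q ^ 3 * ((2 : ℝ) ^ I) ^ ((1 : ℝ) / q))) *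
          (8 * ((2 : ℝ) ^ I) ^ (4 + (3 : ℝ) / q)) := by gcongr
    _ = 36 * 216 * 8 * R * q ^ 3 *
          (((2 : ℝ) ^ I) ^ ((1 : ℝ) / q) * ((2 : ℝ) ^ I) ^ (4 + (3 : ℝ) / q)) := by ring
    _ = 36 * 216 * 8 * R * q ^ 3 * ((2 : ℝ) ^ I) ^ (4 + (4 : ℝ) / q) := by
        rw [← Real.rpow_add (by positivity)]
        congr 2
        ring
    _ ≤ 36 * 216 * 8 * R * q ^ 3 * (256 * (D : ℝ) ^ ((4 : ℝ) / 3 + ε)) := by gcongr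
    _ = _ := by ring

section Graph

variable {G : SimpleGraph (Fin n)} {es : List (Sym2 (Fin n))}

theorem IsEdgeStream.degIn_le [DecidableRel G.Adj] (h : IsEdgeStream G es) (v : Fin n) :
    degIn es v ≤ G.maxDegree := by
  refine le_trans ?_ (G.degree_le_maxDegree v)
  rw [degIn, List.countP_eq_length_filter, ← List.toFinset_card_of_nodup (h.1.filter _),
    ← SimpleGraph.card_incidenceFinset_eq_degree]
  refine Finset.card_le_card fun f hf => ?_
  simp only [List.mem_toFinset, List.mem_filter, decide_eq_true_eq, h.2] at hf
  simpa [SimpleGraph.mem_incidenceFinset, SimpleGraph.incidenceSet] using hf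

theorem IsEdgeStream.isSimpleStream (h : IsEdgeStream G es) : IsSimpleStream es where
  nodup := h.1
  not_isDiag f hf := G.not_isDiag_of_mem_edgeSet ((h.2 f).1 hf)
  degIn_lt v := by
    classical
    have : Nonempty (Fin n) := ⟨v⟩
    simpa using (h.degIn_le v).trans_lt G.maxDegree_lt_card_verts

theorem IsEdgeStream.isProperEdgeColoring_output (h : IsEdgeStream G es) (ω : Seed n R) :
    IsProperEdgeColoring G (output q ω es) := by
  have hp := perm_output (q := q) ω es
  exact ⟨⟨hp.nodup_iff.2 h.1, fun e => hp.mem_iff.trans (h.2 e)⟩,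
    fun _ hp _ hp' hne hw => output_proper h.isSimpleStream ω hp hp' hne hw⟩

theorem IsEdgeStream.eq_nil_of_maxDegree_eq_zero [DecidableRel G.Adj] (h : IsEdgeStream G es)
    (h0 : G.maxDegree = 0) : es = [] := by
  rw [← List.length_eq_zero_iff]
  have h1 := sum_degIn h.isSimpleStream.not_isDiag
  rw [Finset.sum_eq_zero fun v _ => Nat.le_zero.1 (h0 ▸ h.degIn_le v)] at h1
  omega

end Graph

end

theorem theorem1 :
    ∃ A : ℝ, 0 < A ∧ ∀ ε : ℝ, 0 < ε → ∃ K : ℝ, 0 < K ∧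
      ∀ n : ℕ, ∃ 𝒜 : WStreamAlgorithm n,
        ∀ (G : SimpleGraph (Fin n)) [DecidableRel G.Adj] (es : List (Sym2 (Fin n))),
          IsEdgeStream G es →
            (∀ r ∈ (𝒜.run es).support, IsProperEdgeColoring G r.2) ∧
            𝒜.expectedSpace es ≤
              ENNReal.ofReal (K * (max 1 (Real.log (G.maxDegree : ℝ))) ^ (A / ε) * (n : ℝ)) ∧
            𝒜.expectedColors es ≤
              ENNReal.ofReal (K * (max 1 (Real.log (G.maxDegree : ℝ))) ^ (A / ε) *
                (G.maxDegree : ℝ) ^ ((4 : ℝ) / 3 + ε)) := by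
  refine ⟨1, one_pos, fun ε hε => ?_⟩
  obtain ⟨q, hqε⟩ := exists_nat_gt (4 / (3 * ε))
  have hq : 0 < q := by
    have : (0 : ℝ) < q := lt_trans (by positivity) hqε
    exact_mod_cast this
  have hqε' : 4 ≤ 3 * ε * q := by
    rw [div_lt_iff₀ (by positivity)] at hqε
    linarith
  set K₁ : ℝ := 4 * (6 * q) + 4 + 4 * (2 ^ 17) ^ (6 * q)
  set K₂ : ℝ := 36 * 216 * 8 * 256 * (6 * q) * q ^ 3 + 2
  have hK₁ : 0 < K₁ := by positivity
  have hK₂ : 0 < K₂ := by positivity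
  refine ⟨K₁ + K₂, by positivity, fun n => ?_⟩
  have hN : Nonempty (Seed n (6 * q)) :=
    ⟨fun _ v => (⟨0, Nat.mul_pos v.pos v.pos⟩, ⟨0, Nat.mul_pos v.pos v.pos⟩)⟩
  have hS : Nonempty (State n (6 * q)) := ⟨stateAt q (Classical.arbitrary _) [] 0⟩
  refine ⟨(machine n q (6 * q)).toAlgorithm encode
    fun ω : Seed n (6 * q) => stateAt q ω [] 0, ?_⟩
  intro G _ es hG
  have h := hG.isSimpleStream
  set L : ℝ := max 1 (Real.log (G.maxDegree : ℝ)) ^ (1 / ε)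
  have hL : 1 ≤ L := Real.one_le_rpow (le_max_left _ _) (by positivity)
  have hstart : ∀ ω : Seed n (6 * q), stateAt q ω [] 0 = stateAt q ω es 0 := fun ω => by
    simp [stateAt, buffer, leftover, prevBase]
  simp only [hstart]
  have hrun := (machine n q (6 * q)).run_toAlgorithm
    (fun ω : Seed n (6 * q) => stateAt q ω es 0) encode_injective es
  have hexec : ∀ ω : Seed n (6 * q), _ ∧ _ := fun ω =>
    exec_stateAt (q := q) h ω (fun s => (encode s).length)
      (fun k hk => length_encode_stateAt_le ω es hk) (Nat.zero_le _)
  simp only [List.drop_zero, printed, Nat.zero_div, List.range_zero, List.flatMap_nil,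
    List.nil_append] at hexec
  refine ⟨?_, ?_, ?_⟩
  · intro r hr
    rw [hrun, PMF.support_map] at hr
    obtain ⟨ω, -, rfl⟩ := hr
    rw [(hexec ω).2]
    exact hG.isProperEdgeColoring_output ω
  · unfold WStreamAlgorithm.expectedSpace
    rw [hrun]
    refine PMF.tsum_map_uniform_mul_le _ (fun r : ℕ × List (Sym2 (Fin n) × ℕ) => r.1) ?_
    calc _ ≤ ∑ ω : Seed n (6 * q), ((n : ℝ) * (4 * (6 * q) + 4) +
          2 * ((leftover q ω es (es.length / n)).length : ℝ)) :=
          Finset.sum_le_sum fun ω _ => by exact_mod_cast (hexec ω).1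
      _ ≤ Fintype.card (Seed n (6 * q)) * ((n : ℝ) * (4 * (6 * q) + 4)) +
          2 * (2 * (2 ^ 17) ^ (6 * q) * n * Fintype.card (Seed n (6 * q))) := by
          rw [Finset.sum_add_distrib, Finset.sum_const, Finset.card_univ, nsmul_eq_mul,
            ← Finset.mul_sum]
          exact add_le_add le_rfl
            (mul_le_mul_of_nonneg_left (sum_length_leftover_le h hq) two_pos.le)
      _ = K₁ * 1 * n * Fintype.card (Seed n (6 * q)) := by ring
      _ ≤ _ := by
          gcongr
          linarith
  · unfold WStreamAlgorithm.expectedColors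
    rw [hrun]
    refine PMF.tsum_map_uniform_mul_le _
      (fun r : ℕ × List (Sym2 (Fin n) × ℕ) => (r.2.map Prod.snd).toFinset.card) ?_
    have hcol : ∀ ω : Seed n (6 * q),
        (((output q ω es).map Prod.snd).toFinset.card : ℝ) ≤
          (K₁ + K₂) * L * (G.maxDegree : ℝ) ^ ((4 : ℝ) / 3 + ε) := by
      intro ω
      rcases Nat.eq_zero_or_pos G.maxDegree with h0 | h0
      · have h1 := (perm_output (q := q) ω es).length_eq
        rw [hG.eq_nil_of_maxDegree_eq_zero h0] at h1 ⊢
        rw [List.length_map, List.length_nil, List.length_eq_zero_iff] at h1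
        rw [h1]
        simp only [List.map_nil, List.toFinset_nil, Finset.card_empty, Nat.cast_zero]
        positivity
      · have h1 : (1 : ℝ) ≤ G.maxDegree := by exact_mod_cast h0
        have h2 := (Nat.cast_le (α := ℝ)).2 (card_colors_output_le (q := q) h ω hG.degIn_le)
        have h3 := card_palette_clog_le (R := 6 * q) hq h0 hqε'
        have h4 : (G.maxDegree : ℝ) ≤ (G.maxDegree : ℝ) ^ ((4 : ℝ) / 3 + ε) :=
          Real.self_le_rpow_of_one_le h1 (by linarith)
        push_cast at h2 h3
        calc _ ≤ _ := h2
          _ ≤ K₂ * 1 * (G.maxDegree : ℝ) ^ ((4 : ℝ) / 3 + ε) := by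
              simp only [K₂]
              linarith
          _ ≤ _ := by
              gcongr
              linarith
    calc _ ≤ ∑ _ω : Seed n (6 * q), (K₁ + K₂) * L * (G.maxDegree : ℝ) ^ ((4 : ℝ) / 3 + ε) :=
          Finset.sum_le_sum fun ω _ => by rw [(hexec ω).2]; exact hcol ω
      _ = _ := by
          rw [Finset.sum_const, Finset.card_univ, nsmul_eq_mul]
          ring
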